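/- Setting. There are $m\ge 1$ candidates and $n\ge 1$ voters; each vote is a linear order on the candidates. Under the positional scoring rule with score vector $(\alpha_1,\dots,\alpha_m)$ a candidate receives $\alpha_i$ points from each vote that ranks it in position $i$; the winner is the candidate with the highest total score, and ties are broken in favour of the tied candidate that comes first in a predetermined linear order $\succ_t$ on the candidates. *Borda* is the rule with vector $(m-1,m-2,\dots,1,0)$; *$k$-approval*, $1\le k<m$, is the rule with $\alpha_1=\dots=\alpha_k=1$ and $\alpha_{k+1}=\dots=\alpha_m=0$ (plurality is $k=1$, veto is $k=m-1$). The order $\succ_t$, and for $k$-approval also the number $k$, belong to the description of the voting rule and are part of the input. Let $r$ be a voting rule, $(\succ_i)_{i\in V}$ the reported profile of a set $V$ of voters, and $x$ its winner under $r$. A set $M\subseteq V$ is a *coalition of possible manipulators against* a candidate $y$ if $y\ne x$ and there are votes $(\succ'_j)_{j\in M}$, each ranking $x$ above $y$, such that $y$ is the winner under $r$ of the profile in which the voters $j\in M$ vote $\succ'_j$ and all other voters vote $\succ_j$. It is a *coalition of possible manipulators* if it is one against some candidate $y$. Consider the following decision problems, in each of which the voting rule $r$ and the reported profile are part of the input.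 * CPMW: given moreover $M\subseteq V$ and a candidate $y$, is $M$ a coalition of possible manipulators against $y$? * CPM: given moreover $M\subseteq V$, is $M$ a coalition of possible manipulators? * CPMSW: given moreover a candidate $y$ and an integer $\ell\ge 0$, is there a coalition $M\subseteq V$ of possible manipulators against $y$ with $|M|\le \ell$? * CPMS: given moreover an integer $\ell\ge 0$, is there a coalition $M\subseteq V$ of possible manipulators with $|M|\le \ell$? **Corollary.** For the Borda rule, and for the $k$-approval rules (all $1\le k<m$, including plurality), all four problems CPMW, CPM, CPMSW and CPMS are in $\mathsf{P}$: each is decided by a Turing machine in time polynomial in the length of the input, in which the votes are listed one by one as rankings and numbers are written in binary. -/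

import Mathlib

namespace Manip

/-! ### Elections, positional scoring rules, tie breaking -/

/-- A preference (linear order) over the `m` candidates `Fin m`, written as a ranking:
`σ p` is the candidate at position `p` (position `0` is the top), and `σ.symm c` is the position
of the candidate `c`. -/
abbrev Pref (m : ℕ) : Type := Equiv.Perm (Fin m)

/-- A preference profile of `n` voters over `m` candidates. -/
abbrev Profile (n m : ℕ) : Type := Fin n → Pref m

/-- The vote `σ` strictly prefers `a` to `b`. -/
def Pref.Prefers {m : ℕ} (σ : Pref m) (a b : Fin m) : Prop := σ.symm a < σ.symm b

/-- The score of candidate `c`: each vote contributes `α p`, where `p` is the position of `c`. -/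
def score {n m : ℕ} (α : Fin m → ℕ) (P : Profile n m) (c : Fin m) : ℕ :=
  ∑ v, α ((P v).symm c)

/-- The positional scoring correspondence: the candidates of maximum score. -/
def coWinners {n m : ℕ} (α : Fin m → ℕ) (P : Profile n m) : Finset (Fin m) :=
  Finset.univ.filter fun c => ∀ d, score α P d ≤ score α P c

theorem coWinners_nonempty {n m : ℕ} (hm : 0 < m) (α : Fin m → ℕ) (P : Profile n m) :
    (coWinners α P).Nonempty := by
  have : Nonempty (Fin m) := ⟨⟨0, hm⟩⟩
  obtain ⟨c, -, hc⟩ := Finset.exists_max_image (Finset.univ : Finset (Fin m)) (score α P)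
    Finset.univ_nonempty
  exact ⟨c, by simpa [coWinners] using hc⟩

/-- Lexicographic tie breaking: the element of the nonempty set `S` that the predetermined
preference `t` ranks first. -/
def tieBreak {m : ℕ} (t : Pref m) (S : Finset (Fin m)) (hS : S.Nonempty) : Fin m :=
  t ((S.map t.symm.toEmbedding).min' (hS.map))

/-- The voting rule given by the score vector `α` and lexicographic tie breaking with respect
to `t`. -/
def scoringRule {n m : ℕ} (hm : 0 < m) (α : Fin m → ℕ) (t : Pref m) (P : Profile n m) : Fin m :=
  tieBreak t (coWinners α P) (coWinners_nonempty hm α P)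

/-! ### Coalitions of possible manipulators -/

/-- `M` is a coalition of possible manipulators against `y` with respect to the voting rule `r`,
for the reported profile `P`. Only the values of `P'` on `M` are used, so `P'` stands for a
profile of the voters in `M`; `M.piecewise P' P` is `P'` on `M` and `P` off `M`. -/
def IsCoalitionAgainst {n m : ℕ} (r : Profile n m → Fin m) (P : Profile n m)
    (M : Finset (Fin n)) (y : Fin m) : Prop :=
  y ≠ r P ∧ ∃ P' : Profile n m,
    (∀ j ∈ M, (P' j).Prefers (r P) y) ∧ r (M.piecewise P' P) = y

/-- `M` is a coalition of possible manipulators with respect to the voting rule `r`. -/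
def IsCoalition {n m : ℕ} (r : Profile n m → Fin m) (P : Profile n m)
    (M : Finset (Fin n)) : Prop :=
  ∃ y, IsCoalitionAgainst r P M y

/-! ### Families of scoring rules: Borda and approval -/

/-- A family of scoring vectors: for `m` candidates the admissible parameters are `Param m`, the
vector belonging to `a : Param m` is `vec m a`, and `enc m a` is how `a` is written in an input. -/
structure ScoringFamily where
  Param : ℕ → Type
  vec : ∀ m, Param m → Fin m → ℕ
  enc : ∀ m, Param m → List ℕ
  enc_injective : ∀ m, Function.Injective (enc m)

/-- Borda: the score vector is `(m-1, m-2, …, 1, 0)`; there is no parameter. -/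
def borda : ScoringFamily where
  Param _ := Unit
  vec m _ p := m - 1 - p
  enc _ _ := []
  enc_injective _ _ _ _ := rfl

/-- `k`-approval, `1 ≤ k < m`: the first `k` positions score `1`, the others `0`.
The number `k` is part of the input. -/
def approval : ScoringFamily where
  Param m := {k : ℕ // 1 ≤ k ∧ k < m}
  vec _ k p := if (p : ℕ) < k.1 then 1 else 0
  enc _ k := [k.1]
  enc_injective _ a b h := by
    apply Subtype.ext
    simpa using h

/-- An election for a family of scoring rules: numbers of candidates and voters, the voting rule
(parameter of the score vector and tie-breaking preference), and the reported profile. -/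
structure Election (F : ScoringFamily) where
  m : ℕ
  n : ℕ
  m_pos : 0 < m
  n_pos : 0 < n
  param : F.Param m
  tie : Pref m
  votes : Profile n m

/-- The voting rule of an election, as a map on all profiles of its voters. -/
def Election.rule {F : ScoringFamily} (E : Election F) : Profile E.n E.m → Fin E.m :=
  scoringRule E.m_pos (F.vec E.m E.param) E.tie

/-! ### Encoding of inputs

Numbers are written in binary and terminated by a comma; a list is terminated by `ket`. -/

open Computability in
def encodeNumber (a : ℕ) : List Γ' := (encodeNat a).map Γ'.bit ++ [Γ'.comma]

open Computability in
def encodeList (l : List ℕ) : List Γ' := l.flatMap encodeNumber ++ [Γ'.ket]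

open Computability in
def encodeLists (L : List (List ℕ)) : List Γ' := L.flatMap encodeList

/-- A preference is written as the list of the candidates from the first to the last position. -/
def Pref.toList {m : ℕ} (σ : Pref m) : List ℕ := List.ofFn fun p => (σ p : ℕ)

/-- A set of voters is written as its characteristic vector. -/
def voterSetToList {n : ℕ} (M : Finset (Fin n)) : List ℕ :=
  List.ofFn fun v => if v ∈ M then 1 else 0

/-- An election is written as the parameter of the rule, the tie-breaking preference, and the
votes. -/
def Election.toLists {F : ScoringFamily} (E : Election F) : List (List ℕ) :=
  F.enc E.m E.param :: E.tie.toList :: List.ofFn fun v => (E.votes v).toList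

theorem encodeNumber_append_inj {a b : ℕ} {s t : List Computability.Γ'}
    (h : encodeNumber a ++ s = encodeNumber b ++ t) : a = b ∧ s = t := by
  have key : ∀ (u v : List Bool), u.map Computability.Γ'.bit ++ (Computability.Γ'.comma :: s) =
      v.map Computability.Γ'.bit ++ (Computability.Γ'.comma :: t) → u = v ∧ s = t := by
    intro u
    induction u with
    | nil => intro v h; cases v <;> simp_all
    | cons x u ih =>
      intro v h
      cases v with
      | nil => simp_all
      | cons y v =>
        simp only [List.map_cons, List.cons_append, List.cons.injEq,
          Computability.Γ'.bit.injEq] at h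
        obtain ⟨h1, h2⟩ := ih v h.2
        exact ⟨by rw [h.1, h1], h2⟩
  obtain ⟨h1, h2⟩ := key _ _ (by simpa [encodeNumber] using h)
  exact ⟨Computability.encodingNatBool.encode_injective h1, h2⟩

theorem encodeNumber_ne_ket (a : ℕ) (s t : List Computability.Γ') :
    encodeNumber a ++ s ≠ Computability.Γ'.ket :: t := by
  unfold encodeNumber
  cases Computability.encodeNat a <;> simp

theorem encodeList_append_inj {l l' : List ℕ} {s t : List Computability.Γ'}
    (h : encodeList l ++ s = encodeList l' ++ t) : l = l' ∧ s = t := by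
  induction l generalizing l' with
  | nil =>
    cases l' with
    | nil => simpa [encodeList] using h
    | cons b l' =>
      exact absurd (by simpa [encodeList] using h.symm) (encodeNumber_ne_ket b _ _)
  | cons a l ih =>
    cases l' with
    | nil => exact absurd (by simpa [encodeList] using h) (encodeNumber_ne_ket a _ _)
    | cons b l' =>
      have h' : encodeNumber a ++ (encodeList l ++ s) = encodeNumber b ++ (encodeList l' ++ t) := by
        simpa [encodeList] using h
      obtain ⟨h1, h2⟩ := encodeNumber_append_inj h'
      obtain ⟨h3, h4⟩ := ih h2
      exact ⟨by rw [h1, h3], h4⟩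

theorem encodeLists_injective : Function.Injective encodeLists := by
  intro L
  induction L with
  | nil =>
    intro L' h
    cases L' with
    | nil => rfl
    | cons l L' =>
      have := congrArg List.length h
      simp [encodeLists, encodeList] at this
  | cons l L ih =>
    intro L' h
    cases L' with
    | nil =>
      have := congrArg List.length h
      simp [encodeLists, encodeList] at this
    | cons l' L' =>
      obtain ⟨h1, h2⟩ := encodeList_append_inj
        (s := encodeLists L) (t := encodeLists L') (by simpa [encodeLists] using h)
      rw [h1, ih h2]

theorem Pref.toList_injective {m : ℕ} : Function.Injective (Pref.toList (m := m)) := by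
  intro σ τ h
  apply Equiv.ext
  intro p
  exact Fin.ext (congrFun (List.ofFn_injective h) p)

theorem voterSetToList_injective {n : ℕ} : Function.Injective (voterSetToList (n := n)) := by
  intro M N h
  ext v
  have := congrFun (List.ofFn_injective h) v
  by_cases h1 : v ∈ M <;> by_cases h2 : v ∈ N <;> simp_all

theorem Election.toLists_injective {F : ScoringFamily} :
    Function.Injective (Election.toLists (F := F)) := by
  rintro ⟨m, n, hm, hn, a, t, P⟩ ⟨m', n', hm', hn', a', t', P'⟩ h
  simp only [Election.toLists, List.cons.injEq] at h
  obtain ⟨h1, h2, h3⟩ := h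
  obtain rfl : m = m' := by simpa [Pref.toList] using congrArg List.length h2
  obtain rfl : n = n' := by simpa using congrArg List.length h3
  obtain rfl := F.enc_injective m h1
  obtain rfl := Pref.toList_injective h2
  obtain rfl : P = P' := funext fun v =>
    Pref.toList_injective (congrFun (List.ofFn_injective h3) v)
  rfl

/-! ### Decision problems and the class P -/

/-- A decision problem: instances, their encoding as words, and the yes-instances. -/
structure DecisionProblem where
  Inst : Type
  encode : Inst → List Computability.Γ'
  encode_injective : Function.Injective encode
  Yes : Inst → Prop

open Classical in
/-- A decision problem is in P: a Turing machine that gets an encoded instance halts within a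
number of steps polynomial in the length of its input, with the correct yes/no answer. -/
def DecisionProblem.InP (D : DecisionProblem) : Prop :=
  Nonempty (Turing.TM2ComputableInPolyTime D.encode Computability.encodeBool
    fun I => decide (D.Yes I))

/-- CPMW: given an election, a set `M` of voters and a candidate `y`, is `M` a coalition of
possible manipulators against `y`? -/
def CPMW (F : ScoringFamily) : DecisionProblem where
  Inst := Σ E : Election F, Finset (Fin E.n) × Fin E.m
  encode I := encodeLists (voterSetToList I.2.1 :: [(I.2.2 : ℕ)] :: I.1.toLists)
  encode_injective := by
    rintro ⟨E, M, y⟩ ⟨E', M', y'⟩ h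
    have h := encodeLists_injective h
    simp only [List.cons.injEq, and_true] at h
    obtain rfl := Election.toLists_injective h.2.2
    obtain rfl := voterSetToList_injective h.1
    obtain rfl := Fin.ext h.2.1
    rfl
  Yes I := IsCoalitionAgainst I.1.rule I.1.votes I.2.1 I.2.2

/-- CPM: given an election and a set `M` of voters, is `M` a coalition of possible
manipulators? -/
def CPM (F : ScoringFamily) : DecisionProblem where
  Inst := Σ E : Election F, Finset (Fin E.n)
  encode I := encodeLists (voterSetToList I.2 :: I.1.toLists)
  encode_injective := by
    rintro ⟨E, M⟩ ⟨E', M'⟩ h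
    have h := encodeLists_injective h
    simp only [List.cons.injEq] at h
    obtain rfl := Election.toLists_injective h.2
    obtain rfl := voterSetToList_injective h.1
    rfl
  Yes I := IsCoalition I.1.rule I.1.votes I.2

/-- CPMSW: given an election, a candidate `y` and a number `k`, is there a coalition of possible
manipulators against `y` of size at most `k`? -/
def CPMSW (F : ScoringFamily) : DecisionProblem where
  Inst := Σ E : Election F, Fin E.m × ℕ
  encode I := encodeLists ([(I.2.1 : ℕ)] :: [I.2.2] :: I.1.toLists)
  encode_injective := by
    rintro ⟨E, y, k⟩ ⟨E', y', k'⟩ h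
    have h := encodeLists_injective h
    simp only [List.cons.injEq, and_true] at h
    obtain rfl := Election.toLists_injective h.2.2
    obtain rfl := Fin.ext h.1
    obtain rfl := h.2.1
    rfl
  Yes I := ∃ M : Finset (Fin I.1.n), M.card ≤ I.2.2 ∧
    IsCoalitionAgainst I.1.rule I.1.votes M I.2.1

/-- CPMS: given an election and a number `k`, is there a coalition of possible manipulators of
size at most `k`? -/
def CPMS (F : ScoringFamily) : DecisionProblem where
  Inst := Σ _ : Election F, ℕ
  encode I := encodeLists ([I.2] :: I.1.toLists)
  encode_injective := by
    rintro ⟨E, k⟩ ⟨E', k'⟩ h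
    have h := encodeLists_injective h
    simp only [List.cons.injEq, and_true] at h
    obtain rfl := Election.toLists_injective h.2
    obtain rfl := h.1
    rfl
  Yes I := ∃ M : Finset (Fin I.1.n), M.card ≤ I.2 ∧ IsCoalition I.1.rule I.1.votes M

end Manip

namespace Manip

open Turing Computability

/-! ### Counter programs with a read-only input -/

/-! The proof has two halves: each problem is reduced to a criterion made of counts and bounded
sums, and every such criterion is shown to be decidable in polynomial time.

Criteria. With `tiePenalty` equal to 0 or 1, a candidate `y` wins iff score(c) + penalty(c, y) ≤
score(y) for all c ≠ y (`scoringRule_eq_iff`). Let x be the reported winner. For Borda, and for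
k-approval with k ≥ 2, the first two positions differ by an amount g (1, respectively 0) that is a
lower bound for the difference of any higher and lower position. A manipulator must rank x above
`y`, so nothing is better for `y` against x than x first and `y` second. This can be done without
moving anybody else up and without taking points from x; the others then stay behind x, hence behind
`y`, and a single inequality between x and `y` decides (`isCoalitionAgainst_iff_of_hasMinGap`). In
it a manipulator contributes the gain α(x) - α(y) - g of its reported vote, so a coalition of
bounded size should consist of the voters with the largest positive gains. The sum of the k largest
gains is computed without sorting, as the sum over levels j of min(k, number of gains above j)
(`exists_isCoalitionAgainst_iff_of_hasMinGap`).

Plurality is different: a manipulator gives nothing to `y` and its point to an arbitrary other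
candidate. Each c ≠ `y` can absorb points as long as it stays behind `y`, and the total capacity
must accommodate the coalition (`isCoalitionAgainst_plurality_iff`). For the search, it is best to
take from each c exactly the supporters in excess of what the score of `y` tolerates
(`exists_isCoalitionAgainst_plurality_iff`).

Complexity. The criteria are written as expressions with addition, truncated subtraction, bounded
sums and access to the input symbols. All values of such an expression are polynomially bounded, so
a program with unary counters evaluates it in polynomial time (`Expr.exists_run`), and the program
is simulated step by step by a multi-stack Turing machine (`Run.steps`). The input is parsed by
counting separators. Binary numbers may be exponentially large, but only their values truncated at
the input length matter: candidates and k are smaller than that, and no coalition is larger. -/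

/-- Programs over unary counters (indexed by `ℕ`) and an input tape with a reading head. -/
inductive Cmd : Type
  | inc (r : ℕ) : Cmd
  | dec (r : ℕ) : Cmd
  /-- Move the head one symbol to the right. -/
  | next : Cmd
  /-- Increment `r` if the symbol under the head is `s`. -/
  | test (s : Γ') (r : ℕ) : Cmd
  /-- Move the head to the left end. -/
  | rewind : Cmd
  | seq (a b : Cmd) : Cmd
  /-- While `r` is positive, decrement it and run `a`. -/
  | loop (r : ℕ) (a : Cmd) : Cmd
  /-- While the head is not at the right end, move it to the right and run `a`. -/
  | scan (a : Cmd) : Cmd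

/-- The memory of a counter program: the symbols left of the head (in reversed order), the symbols
from the head on, and the counters. -/
structure Mem where
  left : List Γ'
  right : List Γ'
  ctr : ℕ → ℕ

/-- `Run a s t s'`: the program `a` takes the memory from `s` to `s'` in `t` steps. -/
inductive Run : Cmd → Mem → ℕ → Mem → Prop
  | inc (r l w c) : Run (.inc r) ⟨l, w, c⟩ 1 ⟨l, w, Function.update c r (c r + 1)⟩
  | dec (r l w c) : Run (.dec r) ⟨l, w, c⟩ 1 ⟨l, w, Function.update c r (c r - 1)⟩
  | next_nil (l c) : Run .next ⟨l, [], c⟩ 1 ⟨l, [], c⟩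
  | next_cons (l s w c) : Run .next ⟨l, s :: w, c⟩ 1 ⟨s :: l, w, c⟩
  | test_eq (s r l w c) (h : w.head? = some s) :
      Run (.test s r) ⟨l, w, c⟩ 1 ⟨l, w, Function.update c r (c r + 1)⟩
  | test_ne (s r l w c) (h : w.head? ≠ some s) : Run (.test s r) ⟨l, w, c⟩ 1 ⟨l, w, c⟩
  | rewind_nil (w c) : Run .rewind ⟨[], w, c⟩ 1 ⟨[], w, c⟩
  | rewind_cons (s l w c t m) (h : Run .rewind ⟨l, s :: w, c⟩ t m) :
      Run .rewind ⟨s :: l, w, c⟩ (t + 1) m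
  | seq {a b m₁ t₁ m₂ t₂ m₃} (h₁ : Run a m₁ t₁ m₂) (h₂ : Run b m₂ t₂ m₃) :
      Run (.seq a b) m₁ (t₁ + t₂) m₃
  | loop_zero (r a l w c) (h : c r = 0) : Run (.loop r a) ⟨l, w, c⟩ 1 ⟨l, w, c⟩
  | loop_succ {r a l w c t₁ m₂ t₂ m₃} (h : c r ≠ 0)
      (h₁ : Run a ⟨l, w, Function.update c r (c r - 1)⟩ t₁ m₂) (h₂ : Run (.loop r a) m₂ t₂ m₃) :
      Run (.loop r a) ⟨l, w, c⟩ (t₁ + t₂ + 1) m₃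
  | scan_nil (a l c) : Run (.scan a) ⟨l, [], c⟩ 1 ⟨l, [], c⟩
  | scan_cons {a l s w c t₁ m₂ t₂ m₃}
      (h₁ : Run a ⟨s :: l, w, c⟩ t₁ m₂) (h₂ : Run (.scan a) m₂ t₂ m₃) :
      Run (.scan a) ⟨l, s :: w, c⟩ (t₁ + t₂ + 1) m₃

/-- All counters of the program have an index below `n`. -/
def Cmd.Fits (n : ℕ) : Cmd → Prop
  | inc r => r < n
  | dec r => r < n
  | next => True
  | test _ r => r < n
  | rewind => True
  | seq a b => a.Fits n ∧ b.Fits n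
  | loop r a => r < n ∧ a.Fits n
  | scan a => a.Fits n

theorem Cmd.Fits.mono {n n' : ℕ} (h : n ≤ n') : ∀ {a : Cmd}, a.Fits n → a.Fits n'
  | inc _, ha => lt_of_lt_of_le ha h
  | dec _, ha => lt_of_lt_of_le ha h
  | next, _ => trivial
  | test _ _, ha => lt_of_lt_of_le ha h
  | rewind, _ => trivial
  | seq _ _, ha => ⟨ha.1.mono h, ha.2.mono h⟩
  | loop _ _, ha => ⟨lt_of_lt_of_le ha.1 h, ha.2.mono h⟩
  | scan a, ha => Fits.mono (a := a) h ha

theorem Cmd.exists_fits : ∀ a : Cmd, ∃ n, a.Fits n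
  | inc r => ⟨r + 1, Nat.lt_succ_self r⟩
  | dec r => ⟨r + 1, Nat.lt_succ_self r⟩
  | next => ⟨0, trivial⟩
  | test _ r => ⟨r + 1, Nat.lt_succ_self r⟩
  | rewind => ⟨0, trivial⟩
  | seq a b =>
    let ⟨n, hn⟩ := a.exists_fits
    let ⟨n', hn'⟩ := b.exists_fits
    ⟨max n n', hn.mono (le_max_left _ _), hn'.mono (le_max_right _ _)⟩
  | loop r a =>
    let ⟨n, hn⟩ := a.exists_fits
    ⟨max n (r + 1), lt_of_lt_of_le (Nat.lt_succ_self r) (le_max_right _ _),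
      hn.mono (le_max_left _ _)⟩
  | scan a => a.exists_fits

/-! ### Compilation of counter programs to stack machines -/

/-- The stacks: the tape from the head on, the tape left of the head, the output, the counters. -/
abbrev Stk (n : ℕ) : Type := Bool ⊕ Option (Fin n)

/-- The stack alphabets. -/
abbrev StkSym {n : ℕ} : Stk n → Type
  | .inl _ => Γ'
  | .inr _ => Bool

/-- The stack that holds the counter `r`. -/
abbrev ctrStk (n r : ℕ) : Stk (n + 1) := .inr (some (Fin.ofNat (n + 1) r))

/-- The labels of a compiled program. -/
def Cmd.Lab : Cmd → Type
  | seq a b => a.Lab ⊕ b.Lab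
  | loop _ a => Option a.Lab
  | scan a => Option a.Lab
  | _ => Unit

/-- The label at which a compiled program starts. -/
def Cmd.entry : (a : Cmd) → a.Lab
  | inc _ => ()
  | dec _ => ()
  | next => ()
  | test _ _ => ()
  | rewind => ()
  | seq a _ => .inl a.entry
  | loop _ _ => none
  | scan _ => none

theorem Cmd.finite_lab : ∀ a : Cmd, Finite a.Lab
  | inc _ => inferInstanceAs (Finite Unit)
  | dec _ => inferInstanceAs (Finite Unit)
  | next => inferInstanceAs (Finite Unit)
  | test _ _ => inferInstanceAs (Finite Unit)
  | rewind => inferInstanceAs (Finite Unit)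
  | seq a b =>
    have := a.finite_lab
    have := b.finite_lab
    inferInstanceAs (Finite (a.Lab ⊕ b.Lab))
  | loop _ a =>
    have := a.finite_lab
    inferInstanceAs (Finite (Option a.Lab))
  | scan a =>
    have := a.finite_lab
    inferInstanceAs (Finite (Option a.Lab))

/-- The code of a program whose labels are embedded by `e` and which continues at `x`. -/
def Cmd.code (n : ℕ) {Λ : Type} : (a : Cmd) → (a.Lab → Λ) → Λ → a.Lab →
    TM2.Stmt (StkSym (n := n + 1)) Λ (Option Γ')
  | inc r, _, x, _ => .push (ctrStk n r) (fun _ => true) (.goto fun _ => x)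
  | dec r, _, x, _ => .pop (ctrStk n r) (fun _ _ => none) (.goto fun _ => x)
  | next, _, x, _ =>
    .pop (.inl true) (fun _ o => o) (.branch Option.isSome
      (.push (.inl false) (fun v => v.getD .blank) (.goto fun _ => x)) (.goto fun _ => x))
  | test s r, _, x, _ =>
    .peek (.inl true) (fun _ o => o) (.branch (fun v => v == some s)
      (.push (ctrStk n r) (fun _ => true) (.goto fun _ => x)) (.goto fun _ => x))
  | rewind, e, x, _ =>
    .pop (.inl false) (fun _ o => o) (.branch Option.isSome
      (.push (.inl true) (fun v => v.getD .blank) (.goto fun _ => e ())) (.goto fun _ => x))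
  | seq a b, e, x, l => match l with
    | .inl l => a.code n (fun l => e (.inl l)) (e (.inr b.entry)) l
    | .inr l => b.code n (fun l => e (.inr l)) x l
  | loop r a, e, x, l => match l with
    | none => .pop (ctrStk n r) (fun _ o => o.map Γ'.bit) (.branch Option.isSome
        (.goto fun _ => e (some a.entry)) (.goto fun _ => x))
    | some l => a.code n (fun l => e (some l)) (e none) l
  | scan a, e, x, l => match l with
    | none => .pop (.inl true) (fun _ o => o) (.branch Option.isSome
        (.push (.inl false) (fun v => v.getD .blank) (.goto fun _ => e (some a.entry)))
        (.goto fun _ => x))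
    | some l => a.code n (fun l => e (some l)) (e none) l

/-- The stacks that represent a memory. -/
def Mem.stk (n : ℕ) (m : Mem) : (k : Stk (n + 1)) → List (StkSym k)
  | .inl true => m.right
  | .inl false => m.left
  | .inr none => ([] : List Bool)
  | .inr (some i) => List.replicate (m.ctr i) true

theorem Mem.stk_ctrStk {n r : ℕ} (m : Mem) (hr : r < n + 1) :
    m.stk n (ctrStk n r) = List.replicate (m.ctr r) true := by
  simp [Mem.stk, ctrStk, Fin.ofNat, Nat.mod_eq_of_lt hr]

theorem Mem.update_ctrStk {n r : ℕ} (l w : List Γ') (c : ℕ → ℕ) (k : ℕ) (hr : r < n + 1) :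
    Function.update (Mem.stk n ⟨l, w, c⟩) (ctrStk n r) (List.replicate k true : List Bool) =
      Mem.stk n ⟨l, w, Function.update c r k⟩ := by
  funext k'
  rcases k' with (_ | _) | (_ | i)
  · rfl
  · rfl
  · rfl
  · by_cases hi : i = Fin.ofNat (n + 1) r
    · subst hi
      simp only [ctrStk, Function.update_self]
      simp [Mem.stk, Nat.mod_eq_of_lt hr]
    · have h1 : (i : ℕ) ≠ r := by
        rintro rfl
        exact hi (by simp)
      rw [Function.update_of_ne (by simpa [ctrStk] using hi)]
      simp [Mem.stk, h1]

theorem Mem.update_right {n : ℕ} (l w w' : List Γ') (c : ℕ → ℕ) :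
    Function.update (Mem.stk n ⟨l, w, c⟩) (.inl true) w' = Mem.stk n ⟨l, w', c⟩ := by
  funext k'
  rcases k' with (_ | _) | (_ | i) <;> rfl

theorem Mem.update_left {n : ℕ} (l l' w : List Γ') (c : ℕ → ℕ) :
    Function.update (Mem.stk n ⟨l, w, c⟩) (.inl false) l' = Mem.stk n ⟨l', w, c⟩ := by
  funext k'
  rcases k' with (_ | _) | (_ | i) <;> rfl

/-! ### Correctness of the compilation. -/

/-- `Steps f t a b`: `t` steps of `f` lead from `a` to `b`. -/
def Steps {α : Type} (f : α → Option α) (t : ℕ) (a b : α) : Prop :=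
  (flip bind f)^[t] (some a) = some b

theorem Steps.trans {α : Type} {f : α → Option α} {t₁ t₂ : ℕ} {a b c : α}
    (h₁ : Steps f t₁ a b) (h₂ : Steps f t₂ b c) : Steps f (t₁ + t₂) a c := by
  unfold Steps at *
  rw [add_comm, Function.iterate_add_apply, h₁, h₂]

theorem Steps.succ {α : Type} {f : α → Option α} {t : ℕ} {a b c : α}
    (h₁ : f a = some b) (h₂ : Steps f t b c) : Steps f (t + 1) a c := by
  unfold Steps at *
  rw [Function.iterate_succ_apply]
  simpa [flip, h₁] using h₂

theorem Steps.one {α : Type} {f : α → Option α} {a b : α} (h : f a = some b) : Steps f 1 a b := by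
  simpa [Steps, flip] using h

/-- Induction on the run; the step counts of `Run` are chosen to agree exactly with those of the
machine. Quantifying over the embedding `e` of the labels and the exit label `x` lets the induction
enter subprograms, which are run in place inside the same machine `M` with a different continuation.
The internal register ends with an unspecified value since each piece of code overwrites it before
using it. -/
theorem Run.steps {n : ℕ} {Λ : Type} (M : Λ → TM2.Stmt (StkSym (n := n + 1)) Λ (Option Γ'))
    {a : Cmd} {m m' : Mem} {t : ℕ} (h : Run a m t m') :
    ∀ (e : a.Lab → Λ) (x : Λ), (∀ l, M (e l) = a.code n e x l) → a.Fits (n + 1) →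
      ∀ v, ∃ v', Steps (TM2.step M) t ⟨some (e a.entry), v, m.stk n⟩ ⟨some x, v', m'.stk n⟩ := by
  induction h with
  | inc r l w c =>
    intro e x hM hf v
    refine ⟨v, Steps.one ?_⟩
    simp only [TM2.step, hM, Cmd.code, TM2.stepAux]
    rw [← Mem.update_ctrStk l w c _ hf, Mem.stk_ctrStk _ hf]
    rfl
  | dec r l w c =>
    intro e x hM hf v
    refine ⟨none, Steps.one ?_⟩
    simp only [TM2.step, hM, Cmd.code, TM2.stepAux]
    rw [← Mem.update_ctrStk l w c _ hf, Mem.stk_ctrStk _ hf]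
    simp
  | next_nil l c =>
    intro e x hM hf v
    refine ⟨none, Steps.one ?_⟩
    simp only [TM2.step, hM, Cmd.code, TM2.stepAux]
    have : (Mem.stk n ⟨l, [], c⟩ (.inl true)) = ([] : List Γ') := rfl
    rw [this]
    erw [Mem.update_right]
    rfl
  | next_cons l s w c =>
    intro e x hM hf v
    refine ⟨some s, Steps.one ?_⟩
    simp only [TM2.step, hM, Cmd.code, TM2.stepAux]
    have : (Mem.stk n ⟨l, s :: w, c⟩ (.inl true)) = (s :: w : List Γ') := rfl
    rw [this]
    erw [Mem.update_right, Mem.update_left]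
    rfl
  | test_eq s r l w c h =>
    intro e x hM hf v
    refine ⟨some s, Steps.one ?_⟩
    simp only [TM2.step, hM, Cmd.code, TM2.stepAux]
    have : (Mem.stk n ⟨l, w, c⟩ (.inl true)) = w := rfl
    rw [this]
    erw [h]
    rw [← Mem.update_ctrStk l w c _ hf, Mem.stk_ctrStk _ hf]
    simp
    rfl
  | test_ne s r l w c h =>
    intro e x hM hf v
    refine ⟨w.head?, Steps.one ?_⟩
    simp only [TM2.step, hM, Cmd.code, TM2.stepAux]
    have : (Mem.stk n ⟨l, w, c⟩ (.inl true)) = w := rfl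
    rw [this]
    have : (w.head? == some s) = false := by simpa using h
    erw [this]
    rfl
  | rewind_nil w c =>
    intro e x hM hf v
    refine ⟨none, Steps.one ?_⟩
    simp only [TM2.step, hM, Cmd.code, TM2.stepAux]
    have : (Mem.stk n ⟨[], w, c⟩ (.inl false)) = ([] : List Γ') := rfl
    rw [this]
    erw [Mem.update_left]
    rfl
  | rewind_cons s l w c t m h ih =>
    intro e x hM hf v
    obtain ⟨v', hv'⟩ := ih e x hM hf (some s)
    refine ⟨v', ?_⟩
    refine Steps.succ ?_ hv'
    simp only [TM2.step, hM, Cmd.code, TM2.stepAux]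
    have : (Mem.stk n ⟨s :: l, w, c⟩ (.inl false)) = (s :: l : List Γ') := rfl
    rw [this]
    erw [Mem.update_left, Mem.update_right]
    rfl
  | @seq a b m₁ t₁ m₂ t₂ m₃ h₁ h₂ ih₁ ih₂ =>
    intro e x hM hf v
    obtain ⟨v₁, hv₁⟩ := ih₁ (fun l => e (.inl l)) (e (.inr b.entry)) (fun l => hM (.inl l)) hf.1 v
    obtain ⟨v₂, hv₂⟩ := ih₂ (fun l => e (.inr l)) x (fun l => hM (.inr l)) hf.2 v₁
    exact ⟨v₂, hv₁.trans hv₂⟩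
  | loop_zero r a l w c h =>
    intro e x hM hf v
    refine ⟨none, Steps.one ?_⟩
    have hM' := hM none
    simp only [TM2.step, Cmd.entry]
    rw [hM']
    simp only [Cmd.code, TM2.stepAux]
    rw [Mem.stk_ctrStk _ hf.1]
    have := Mem.update_ctrStk l w c 0 hf.1
    simp only [h, List.replicate_zero, List.tail_nil, List.head?_nil] at this ⊢
    erw [this]
    rw [← h, Function.update_eq_self]
    rfl
  | @loop_succ r a l w c t₁ m₂ t₂ m₃ h h₁ h₂ ih₁ ih₂ =>
    intro e x hM hf v
    obtain ⟨v₁, hv₁⟩ := ih₁ (fun l => e (some l)) (e none) (fun l => hM (some l)) hf.2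
      (some (Γ'.bit true))
    obtain ⟨v₂, hv₂⟩ := ih₂ e x hM hf v₁
    refine ⟨v₂, ?_⟩
    refine Steps.succ ?_ (hv₁.trans hv₂)
    have hM' := hM none
    simp only [TM2.step, Cmd.entry]
    rw [hM']
    simp only [Cmd.code, TM2.stepAux]
    rw [Mem.stk_ctrStk _ hf.1]
    have := Mem.update_ctrStk l w c (c r - 1) hf.1
    obtain ⟨k, hk⟩ := Nat.exists_eq_succ_of_ne_zero h
    simp only [hk, Nat.succ_eq_add_one, List.replicate_succ, List.tail_cons, List.head?_cons,
      Nat.add_sub_cancel] at this ⊢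
    erw [this]
    rfl
  | scan_nil a l c =>
    intro e x hM hf v
    refine ⟨none, Steps.one ?_⟩
    have hM' := hM none
    simp only [TM2.step, Cmd.entry]
    rw [hM']
    simp only [Cmd.code, TM2.stepAux]
    have : (Mem.stk n ⟨l, [], c⟩ (.inl true)) = ([] : List Γ') := rfl
    rw [this]
    erw [Mem.update_right]
    rfl
  | @scan_cons a l s w c t₁ m₂ t₂ m₃ h₁ h₂ ih₁ ih₂ =>
    intro e x hM hf v
    obtain ⟨v₁, hv₁⟩ := ih₁ (fun l => e (some l)) (e none) (fun l => hM (some l)) hf (some s)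
    obtain ⟨v₂, hv₂⟩ := ih₂ e x hM hf v₁
    refine ⟨v₂, ?_⟩
    refine Steps.succ ?_ (hv₁.trans hv₂)
    have hM' := hM none
    simp only [TM2.step, Cmd.entry]
    rw [hM']
    simp only [Cmd.code, TM2.stepAux]
    have : (Mem.stk n ⟨l, s :: w, c⟩ (.inl true)) = (s :: w : List Γ') := rfl
    rw [this]
    erw [Mem.update_right, Mem.update_left]
    rfl

/-- The machine that runs `a`, erases its input, and outputs whether the counter `0` is
positive. -/
noncomputable def Cmd.machine (a : Cmd) (n : ℕ) : FinTM2 where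
  K := Stk (n + 1)
  k₀ := .inl true
  k₁ := .inr none
  Γ := StkSym
  Λ := Option a.Lab
  main := some a.entry
  ΛFin := @Fintype.ofFinite _ (@instFiniteOption _ a.finite_lab)
  σ := Option Γ'
  initialState := none
  Γk₀Fin := inferInstanceAs (Fintype Γ')
  m
    | some l => a.code n some none l
    | none => .pop (.inl true) (fun _ o => o) (.branch Option.isSome (.goto fun _ => none)
        (.pop (ctrStk n 0) (fun _ o => o.map Γ'.bit)
          (.push (.inr none) (fun v => (v.isSome : Bool)) (.load (fun _ => none) .halt))))

theorem initList_machine (a : Cmd) (n : ℕ) (w : List Γ') :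
    initList (a.machine n) w = ⟨some (some a.entry), none, Mem.stk n ⟨[], w, fun _ => 0⟩⟩ := by
  unfold initList
  congr 1
  funext k
  rcases k with (_ | _) | (_ | i) <;> rfl

theorem haltList_machine (a : Cmd) (n : ℕ) (b : Bool) :
    haltList (a.machine n) ([b] : List Bool) =
      ⟨none, none, Function.update (Mem.stk n ⟨[], [], fun _ => 0⟩) (.inr none)
        ([b] : List Bool)⟩ := by
  unfold haltList
  congr 1
  funext k
  rcases k with (_ | _) | (_ | i) <;> rfl

/-- A halting configuration must have all stacks empty except the output, and the register reset.
The input is popped symbol by symbol, and a single pop both reads and clears counter `0`, which is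
why `k ≤ 1` is required. -/
theorem machine_erase (a : Cmd) (n k : ℕ) (hk : k ≤ 1) (w : List Γ') : ∀ v,
    Steps (a.machine n).step (w.length + 1)
      ⟨some none, v, Mem.stk n ⟨[], w, Function.update (fun _ => 0) 0 k⟩⟩
      ⟨none, none, Function.update (Mem.stk n ⟨[], [], fun _ => 0⟩) (.inr none)
        ([decide (k = 1)] : List Bool)⟩ := by
  induction w with
  | nil =>
    intro v
    refine Steps.one ?_
    simp only [FinTM2.step, TM2.step, Cmd.machine, TM2.stepAux]
    have : (Mem.stk n ⟨[], [], Function.update (fun _ => 0) 0 k⟩ (.inl true)) =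
      ([] : List Γ') := rfl
    rw [this]
    erw [Mem.update_right]
    simp only [List.head?_nil, Option.isSome_none, cond_false]
    rw [Mem.stk_ctrStk _ (Nat.succ_pos n)]
    have h := Mem.update_ctrStk (n := n) [] [] (Function.update (fun _ => 0) 0 k) 0
      (Nat.succ_pos n)
    have h0 : Function.update (Function.update (fun _ => 0) 0 k) 0 0 = fun _ : ℕ => 0 := by
      funext i
      by_cases hi : i = 0 <;> simp [Function.update, hi]
    rw [h0] at h
    interval_cases k
    · simp only [Function.update_self, List.replicate_zero, List.tail_nil, List.head?_nil] at h ⊢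
      erw [h]
      rfl
    · simp only [Function.update_self, List.replicate_zero, List.replicate_one, List.tail_cons,
        List.head?_cons] at h ⊢
      erw [h]
      rfl
  | cons s w ih =>
    intro v
    refine Steps.succ ?_ (ih (some s))
    simp only [FinTM2.step, TM2.step, Cmd.machine, TM2.stepAux]
    have : (Mem.stk n ⟨[], s :: w, Function.update (fun _ => 0) 0 k⟩ (.inl true)) =
      (s :: w : List Γ') := rfl
    rw [this]
    erw [Mem.update_right]
    rfl

/-- A problem is in P if it is decided by a counter program in polynomial time. -/
theorem DecisionProblem.inP_of_run (D : DecisionProblem) (a : Cmd) (p : Polynomial ℕ)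
    (f : D.Inst → ℕ) (hf : ∀ I, f I ≤ 1) (hD : ∀ I, f I = 1 ↔ D.Yes I)
    (h : ∀ I, ∃ t ≤ p.eval (D.encode I).length,
      Run a ⟨[], D.encode I, fun _ => 0⟩ t
        ⟨[], D.encode I, Function.update (fun _ => 0) 0 (f I)⟩) : D.InP := by
  classical
  obtain ⟨n, hn⟩ := a.exists_fits
  choose t ht hrun using h
  -- `p` pays for the program, `X + 1` for erasing the input and writing the answer.
  refine ⟨{ tm := a.machine n, inputAlphabet := Equiv.refl _, outputAlphabet := Equiv.refl _,
            time := p + Polynomial.X + 1, outputsFun := fun I => ?_ }⟩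
  refine ⟨⟨t I + ((D.encode I).length + 1), ?_⟩, ?_⟩
  · obtain ⟨v, hv⟩ := (hrun I).steps (n := n) (a.machine n).m some none (fun _ => rfl)
      (hn.mono (Nat.le_succ n)) none
    have h1 : Steps (a.machine n).step _ _ _ :=
      Steps.trans hv (machine_erase a n (f I) (hf I) (D.encode I) v)
    have h2 : (D.encode I).map (Equiv.refl Γ').invFun = D.encode I := by simp
    have h3 : (encodeBool (decide (D.Yes I))).map (Equiv.refl Bool).invFun =
        [decide (f I = 1)] := by
      simp [encodeBool, hD]
    erw [h2, h3, initList_machine, Option.map_some, haltList_machine]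
    exact h1
  · have := ht I
    simp
    omega

end Manip

namespace Manip

open Turing Computability

/-! ### Counting expressions -/

/-- Arithmetic expressions with bounded sums, over an input word and variables indexed by `ℕ`. -/
inductive Expr : Type
  | var (j : ℕ) : Expr
  | one : Expr
  /-- The length of the input word. -/
  | len : Expr
  /-- `1` if the input word has the symbol `s` at the given position, otherwise `0`. -/
  | sym (s : Γ') (a : Expr) : Expr
  | add (a b : Expr) : Expr
  | sub (a b : Expr) : Expr
  /-- The sum of the values of `b` for the values of variable `j` below the value of `a`. -/
  | sum (j : ℕ) (a b : Expr) : Expr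

def Expr.eval (w : List Γ') : Expr → (ℕ → ℕ) → ℕ
  | var j, env => env j
  | one, _ => 1
  | len, _ => w.length
  | sym s a, env => if w[a.eval w env]? = some s then 1 else 0
  | add a b, env => a.eval w env + b.eval w env
  | sub a b, env => a.eval w env - b.eval w env
  | sum j a b, env => ∑ i ∈ Finset.range (a.eval w env), b.eval w (Function.update env j i)

/-- The program that adds the value of an expression to the counter `dst`, where variable `j` is
kept in the counter `ρ j` and the counters from `f` on are free. -/
def Expr.compile : Expr → (ℕ → ℕ) → ℕ → ℕ → Cmd
  -- Reading a counter by a loop destroys it, so its value is first moved to `f` and then moved back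
  -- while being added to `dst`.
  | var j, ρ, f, dst =>
    .seq (.loop (ρ j) (.inc f)) (.loop f (.seq (.inc (ρ j)) (.inc dst)))
  | one, _, _, dst => .inc dst
  | len, _, _, dst => .seq (.scan (.inc dst)) .rewind
  | sym s a, ρ, f, dst =>
    .seq (a.compile ρ (f + 1) f) (.seq (.loop f .next) (.seq (.test s dst) .rewind))
  | add a b, ρ, f, dst => .seq (a.compile ρ f dst) (b.compile ρ f dst)
  | sub a b, ρ, f, dst =>
    .seq (a.compile ρ (f + 1) f) (.seq (b.compile ρ (f + 2) (f + 1))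
      (.seq (.loop (f + 1) (.dec f)) (.loop f (.inc dst))))
  | sum j a b, ρ, f, dst =>
    .seq (a.compile ρ (f + 1) f) (.seq
      (.loop f (.seq (b.compile (Function.update ρ j (f + 1)) (f + 2) dst) (.inc (f + 1))))
      -- This only clears the index counter `f + 1`: the body has no effect because `f` is already
      -- zero.
      (.loop (f + 1) (.dec f)))

theorem Run.congr {a : Cmd} {m : Mem} {t : ℕ} {l l' w w' : List Γ'} {c c' : ℕ → ℕ}
    (h : Run a m t ⟨l, w, c⟩) (hl : l = l') (hw : w = w') (hc : ∀ i, c i = c' i) :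
    Run a m t ⟨l', w', c'⟩ := by
  obtain rfl : c = c' := funext hc
  subst hl hw
  exact h

/-- Loop rule with a prescribed trajectory: `m i` is the memory after `i` rounds, and each round
costs its body plus one test. -/
theorem Run.loop_of_forall {r : ℕ} {a : Cmd} (T k : ℕ) : ∀ (m : ℕ → Mem),
    (∀ i ≤ k, (m i).ctr r = k - i) →
    (∀ i < k, ∃ t ≤ T, Run a
      ⟨(m i).left, (m i).right, Function.update (m i).ctr r (k - i - 1)⟩ t (m (i + 1))) →
    ∃ t ≤ k * (T + 1) + 1, Run (.loop r a) (m 0) t (m k) := by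
  induction k with
  | zero =>
    intro m hr _
    exact ⟨1, by simp, Run.loop_zero r a _ _ _ (by simpa using hr 0 le_rfl)⟩
  | succ k ih =>
    intro m hr h
    obtain ⟨t₁, ht₁, h₁⟩ := h 0 (Nat.succ_pos k)
    obtain ⟨t₂, ht₂, h₂⟩ := ih (fun i => m (i + 1))
      (fun i hi => by rw [hr (i + 1) (by omega)]; omega)
      (fun i hi => by
        obtain ⟨t, ht, h'⟩ := h (i + 1) (by omega)
        refine ⟨t, ht, ?_⟩
        rwa [show k + 1 - (i + 1) - 1 = k - i - 1 by omega] at h')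
    have h0 := hr 0 (by omega)
    refine ⟨t₁ + t₂ + 1, by rw [Nat.succ_mul]; omega, Run.loop_succ (by omega) ?_ h₂⟩
    rw [h0]
    exact h₁

theorem Run.rewind (l : List Γ') : ∀ (w : List Γ') (c : ℕ → ℕ),
    Run .rewind ⟨l, w, c⟩ (l.length + 1) ⟨[], l.reverse ++ w, c⟩ := by
  induction l with
  | nil => exact fun w c => Run.rewind_nil w c
  | cons s l ih =>
    intro w c
    refine Run.rewind_cons _ _ _ _ _ _ ?_
    simpa using ih (s :: w) c

theorem Run.scan_inc (r : ℕ) (w : List Γ') : ∀ (l : List Γ') (c : ℕ → ℕ),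
    Run (.scan (.inc r)) ⟨l, w, c⟩ (2 * w.length + 1)
      ⟨w.reverse ++ l, [], Function.update c r (c r + w.length)⟩ := by
  induction w with
  | nil =>
    intro l c
    exact (Run.scan_nil _ l c).congr rfl rfl (by simp)
  | cons s w ih =>
    intro l c
    have h := Run.scan_cons (Run.inc r (s :: l) w c) (ih (s :: l) _)
    rw [show 2 * (s :: w).length + 1 = 1 + (2 * w.length + 1) + 1 by simp; omega]
    refine h.congr (by simp) rfl (fun i => ?_)
    by_cases hi : i = r
    · subst hi
      simp
      omega
    · simp [hi]

/-! ### Polynomial bounds for values and running times. -/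

/-- Inside a sum the index is bounded by the value p(B) of the range, so the summand is bounded by
q(B + p(B)). Polynomials are closed under this composition, and the nesting depth is fixed by the
expression. -/
theorem Expr.exists_eval_le (a : Expr) : ∃ q : Polynomial ℕ, ∀ (w : List Γ') (env : ℕ → ℕ) (B : ℕ),
    w.length ≤ B → (∀ j, env j ≤ B) → a.eval w env ≤ q.eval B := by
  induction a with
  | var j => exact ⟨.X, fun w env B _ h => by simpa [eval] using h j⟩
  | one => exact ⟨1, fun w env B _ h => by simp [eval]⟩
  | len => exact ⟨.X, fun w env B hw h => by simpa [eval] using hw⟩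
  | sym s a _ =>
    refine ⟨1, fun w env B hw h => ?_⟩
    simp only [eval, Polynomial.eval_one]
    split_ifs <;> simp
  | add a b ha hb =>
    obtain ⟨p, hp⟩ := ha
    obtain ⟨q, hq⟩ := hb
    refine ⟨p + q, fun w env B hw h => ?_⟩
    simpa [eval] using add_le_add (hp w env B hw h) (hq w env B hw h)
  | sub a b ha _ =>
    obtain ⟨p, hp⟩ := ha
    exact ⟨p, fun w env B hw h => (Nat.sub_le _ _).trans (hp w env B hw h)⟩
  | sum j a b ha hb =>
    obtain ⟨p, hp⟩ := ha
    obtain ⟨q, hq⟩ := hb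
    refine ⟨p * q.comp (.X + p), fun w env B hw h => ?_⟩
    have h1 := hp w env B hw h
    simp only [eval, Polynomial.eval_mul, Polynomial.eval_comp, Polynomial.eval_add,
      Polynomial.eval_X]
    refine (Finset.sum_le_card_nsmul _ _ (q.eval (B + p.eval B)) fun i hi => ?_).trans ?_
    · refine hq w _ _ (hw.trans (Nat.le_add_right _ _)) fun k => ?_
      rw [Finset.mem_range] at hi
      by_cases hk : k = j
      · subst hk
        simp
        omega
      · simpa [hk] using (h k).trans (Nat.le_add_right _ _)
    · simpa using Nat.mul_le_mul_right _ h1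

/-- The invariant carried by the induction: the free counters from `f` on are zero at the start, and
only `dst` differs at the end, so scratch space is clean again. The polynomial does not depend on
`ρ`, `f`, `dst` or the memory, because a sum runs its body with the index placed in a fresh counter
and with the larger bound B + p'(B). -/
theorem Expr.exists_run (a : Expr) : ∃ p : Polynomial ℕ, ∀ (ρ : ℕ → ℕ) (f dst : ℕ) (w : List Γ')
    (c : ℕ → ℕ) (B : ℕ), (∀ j, ρ j < f) → dst < f → (∀ j, ρ j ≠ dst) → (∀ i, f ≤ i → c i = 0) →
    w.length ≤ B → (∀ j, c (ρ j) ≤ B) → ∃ t ≤ p.eval B, Run (a.compile ρ f dst) ⟨[], w, c⟩ t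
      ⟨[], w, Function.update c dst (c dst + a.eval w (c ∘ ρ))⟩ := by
  induction a with
  | var j =>
    refine ⟨(.X * 2 + 1) + (.X * 3 + 1), fun ρ f dst w c B hρ hdst hne hf hw hB => ?_⟩
    have hj := hρ j
    have hnj := hne j
    have hf0 := hf f le_rfl
    obtain ⟨t₁, ht₁, h₁⟩ := Run.loop_of_forall (r := ρ j) (a := .inc f) 1 (c (ρ j))
      (fun i => ⟨[], w, Function.update (Function.update c (ρ j) (c (ρ j) - i)) f i⟩)
      (fun i hi => by simp [hj.ne])
      (fun i hi => ⟨1, le_rfl, (Run.inc f [] w _).congr rfl rfl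
        (fun k => by simp only [Function.update_apply]; grind)⟩)
    obtain ⟨t₂, ht₂, h₂⟩ := Run.loop_of_forall (r := f) (a := .seq (.inc (ρ j)) (.inc dst)) 2
      (c (ρ j))
      (fun i => ⟨[], w, Function.update (Function.update (Function.update c (ρ j) i) f
        (c (ρ j) - i)) dst (c dst + i)⟩)
      (fun i hi => by simp [hdst.ne'])
      (fun i hi => ⟨1 + 1, le_rfl, ((Run.inc (ρ j) [] w _).seq (Run.inc dst [] w _)).congr rfl rfl
        (fun k => by simp only [Function.update_apply]; grind)⟩)
    have hBj := hB j
    have h0 : Function.update (Function.update c (ρ j) (c (ρ j) - 0)) f 0 = c := by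
      funext k
      simp only [Function.update_apply]
      grind
    rw [h0] at h₁
    refine ⟨t₁ + t₂, ?_, (h₁.congr rfl rfl ?_).seq (h₂.congr rfl rfl ?_)⟩
    · simp
      omega
    all_goals
      intro k
      simp only [Function.update_apply, Expr.eval, Function.comp]
      grind
  | one =>
    exact ⟨1, fun ρ f dst w c B _ _ _ _ _ _ => ⟨1, by simp, Run.inc dst [] w c⟩⟩
  | len =>
    refine ⟨.X * 3 + 2, fun ρ f dst w c B _ _ _ _ hw _ => ?_⟩
    refine ⟨_, ?_, (Run.scan_inc dst w [] c).seq ((Run.rewind _ _ _).congr rfl (by simp)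
      (fun _ => rfl))⟩
    simp
    omega
  | sym s a ha =>
    obtain ⟨p, hp⟩ := ha
    obtain ⟨q, hq⟩ := a.exists_eval_le
    refine ⟨p + (q * 2 + 1) + (.X + 2), fun ρ f dst w c B hρ hdst hne hf hw hB => ?_⟩
    have hf0 := hf f le_rfl
    obtain ⟨t₁, ht₁, h₁⟩ := hp ρ (f + 1) f w c B (fun j => (hρ j).trans (Nat.lt_succ_self f))
      (Nat.lt_succ_self f) (fun j => (hρ j).ne) (fun i hi => hf i (by omega)) hw hB
    have hk := hq w (c ∘ ρ) B hw hB
    generalize hv : a.eval w (c ∘ ρ) = k at *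
    obtain ⟨t₂, ht₂, h₂⟩ := Run.loop_of_forall (r := f) (a := .next) 1 k
      (fun i => ⟨(w.take i).reverse, w.drop i, Function.update c f (k - i)⟩)
      (fun i hi => by simp)
      (fun i hi => ⟨1, le_rfl, by
        rcases hd : w.drop i with _ | ⟨s, w'⟩
        · have hlen : w.length ≤ i := by simpa using hd
          have h1 : w.drop (i + 1) = [] := by simp; omega
          have h2 : w.take (i + 1) = w.take i := by
            rw [List.take_of_length_le hlen, List.take_of_length_le (by omega)]
          simp only [h1, h2]
          exact (Run.next_nil _ _).congr rfl rfl (fun j => by simp [Nat.sub_sub])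
        · have h1 : w.drop (i + 1) = w' := by
            rw [← List.tail_drop, hd]
            rfl
          have hlt : i < w.length := by
            by_contra hcon
            rw [List.drop_of_length_le (by omega)] at hd
            cases hd
          have h2 : w.take (i + 1) = w.take i ++ [s] := by
            have h3 : w[i]? = some s := by
              rw [← List.head?_drop, hd]
              rfl
            rw [List.take_add_one, h3]
            rfl
          simp only [h1, h2]
          exact (Run.next_cons _ _ _ _).congr (by simp) rfl (fun j => by simp [Nat.sub_sub])⟩)
    have h₃ : Run (.test s dst) ⟨(w.take k).reverse, w.drop k, c⟩ 1
        ⟨(w.take k).reverse, w.drop k,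
          Function.update c dst (c dst + (if w[k]? = some s then 1 else 0))⟩ := by
      by_cases hs : w[k]? = some s
      · rw [if_pos hs]
        exact Run.test_eq _ _ _ _ _ (by rwa [List.head?_drop])
      · rw [if_neg hs]
        exact (Run.test_ne _ _ _ _ _ (by rwa [List.head?_drop])).congr rfl rfl (by simp)
    refine ⟨_, ?_, (h₁.congr rfl rfl (c' := Function.update c f (k - 0)) (by simp [hf0])).seq
      ((h₂.congr rfl rfl (c' := c) ?_).seq (h₃.seq ((Run.rewind _ _ _).congr rfl (by simp)
        (fun i => ?_))))⟩
    · simp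
      have := Nat.mul_le_mul_right 2 hk
      omega
    · intro i
      by_cases hi : i = f
      · simp [hi, hf0]
      · simp [hi]
    · simp [Expr.eval, hv]
  | add a b ha hb =>
    obtain ⟨p, hp⟩ := ha
    obtain ⟨q, hq⟩ := hb
    refine ⟨p + q, fun ρ f dst w c B hρ hdst hne hf hw hB => ?_⟩
    obtain ⟨t₁, ht₁, h₁⟩ := hp ρ f dst w c B hρ hdst hne hf hw hB
    obtain ⟨t₂, ht₂, h₂⟩ := hq ρ f dst w
      (Function.update c dst (c dst + a.eval w (c ∘ ρ))) B hρ hdst hne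
      (fun i hi => by rw [Function.update_of_ne (by omega), hf i hi]) hw
      (fun j => by rw [Function.update_of_ne (hne j)]; exact hB j)
    refine ⟨_, ?_, h₁.seq (h₂.congr rfl rfl fun i => ?_)⟩
    · simp
      omega
    · have : Function.update c dst (c dst + a.eval w (c ∘ ρ)) ∘ ρ = c ∘ ρ := by
        funext j
        simp [hne j]
      rw [this]
      by_cases hi : i = dst
      · simp [hi, Expr.eval, add_assoc]
      · simp [hi]
  | sub a b ha hb =>
    obtain ⟨p, hp⟩ := ha
    obtain ⟨q, hq⟩ := hb
    obtain ⟨p', hp'⟩ := a.exists_eval_le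
    obtain ⟨q', hq'⟩ := b.exists_eval_le
    refine ⟨p + q + (q' * 2 + 1) + (p' * 2 + 1), fun ρ f dst w c B hρ hdst hne hf hw hB => ?_⟩
    obtain ⟨t₁, ht₁, h₁⟩ := hp ρ (f + 1) f w c B (fun j => (hρ j).trans (Nat.lt_succ_self f))
      (Nat.lt_succ_self f) (fun j => (hρ j).ne) (fun i hi => hf i (by omega)) hw hB
    obtain ⟨t₂, ht₂, h₂⟩ := hq ρ (f + 2) (f + 1) w
      (Function.update c f (c f + a.eval w (c ∘ ρ))) B
      (fun j => (hρ j).trans (by omega)) (by omega) (fun j => ((hρ j).trans (by omega)).ne)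
      (fun i hi => by rw [Function.update_of_ne (by omega), hf i (by omega)]) hw
      (fun j => by rw [Function.update_of_ne (hρ j).ne]; exact hB j)
    have hcρ : Function.update c f (c f + a.eval w (c ∘ ρ)) ∘ ρ = c ∘ ρ := by
      funext j
      simp [(hρ j).ne]
    rw [hcρ] at h₂
    have hka := hp' w (c ∘ ρ) B hw hB
    have hkb := hq' w (c ∘ ρ) B hw hB
    simp only [Expr.eval]
    generalize a.eval w (c ∘ ρ) = x at *
    generalize b.eval w (c ∘ ρ) = y at *
    have hf0 := hf f le_rfl
    have hf1 := hf (f + 1) (by omega)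
    obtain ⟨t₃, ht₃, h₃⟩ := Run.loop_of_forall (r := f + 1) (a := .dec f) 1 y
      (fun i => ⟨[], w, Function.update (Function.update c f (x - i)) (f + 1) (y - i)⟩)
      (fun i hi => by simp)
      (fun i hi => ⟨1, le_rfl, (Run.dec f [] w _).congr rfl rfl
        (fun k => by simp only [Function.update_apply]; grind)⟩)
    obtain ⟨t₄, ht₄, h₄⟩ := Run.loop_of_forall (r := f) (a := .inc dst) 1 (x - y)
      (fun i => ⟨[], w, Function.update (Function.update c f (x - y - i)) dst (c dst + i)⟩)
      (fun i hi => by simp [hdst.ne'])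
      (fun i hi => ⟨1, le_rfl, (Run.inc dst [] w _).congr rfl rfl
        (fun k => by simp only [Function.update_apply]; grind)⟩)
    refine ⟨_, ?_, h₁.seq ((h₂.congr rfl rfl ?_).seq ((h₃.congr rfl rfl ?_).seq
      (h₄.congr rfl rfl ?_)))⟩
    · simp
      have := Nat.mul_le_mul_right 2 hka
      have := Nat.mul_le_mul_right 2 hkb
      omega
    all_goals
      intro k
      simp only [Function.update_apply]
      grind
  | sum j a b ha hb =>
    obtain ⟨p, hp⟩ := ha
    obtain ⟨q, hq⟩ := hb
    obtain ⟨p', hp'⟩ := a.exists_eval_le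
    refine ⟨p + (p' * (q.comp (.X + p') + 2) + 1) + (p' * 2 + 1),
      fun ρ f dst w c B hρ hdst hne hf hw hB => ?_⟩
    have hf0 := hf f le_rfl
    have hf1 := hf (f + 1) (by omega)
    obtain ⟨t₁, ht₁, h₁⟩ := hp ρ (f + 1) f w c B (fun j => (hρ j).trans (Nat.lt_succ_self f))
      (Nat.lt_succ_self f) (fun j => (hρ j).ne) (fun i hi => hf i (by omega)) hw hB
    have hk := hp' w (c ∘ ρ) B hw hB
    simp only [Expr.eval]
    generalize a.eval w (c ∘ ρ) = k at *
    set g : ℕ → ℕ := fun i => ∑ i ∈ Finset.range i, b.eval w (Function.update (c ∘ ρ) j i) with hg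
    have hgs : ∀ i, g (i + 1) = g i + b.eval w (Function.update (c ∘ ρ) j i) :=
      fun i => Finset.sum_range_succ _ _
    obtain ⟨t₂, ht₂, h₂⟩ := Run.loop_of_forall (r := f)
      (a := .seq (b.compile (Function.update ρ j (f + 1)) (f + 2) dst) (.inc (f + 1)))
      (q.eval (B + p'.eval B) + 1) k
      (fun i => ⟨[], w, Function.update (Function.update (Function.update c f (k - i)) (f + 1) i)
        dst (c dst + g i)⟩)
      (fun i hi => by simp [hdst.ne'])
      (fun i hi => by
        obtain ⟨t, ht, h⟩ := hq (Function.update ρ j (f + 1)) (f + 2) dst w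
          (Function.update (Function.update (Function.update c f (k - i - 1)) (f + 1) i)
            dst (c dst + g i)) (B + p'.eval B)
          (fun j' => by have := hρ j'; simp only [Function.update_apply]; grind)
          (by omega)
          (fun j' => by have := hne j'; simp only [Function.update_apply]; grind)
          (fun i' hi' => by
            have := hf i' (by omega)
            simp only [Function.update_apply]
            grind)
          (by omega)
          (fun j' => by
            have := hρ j'
            have := hne j'
            have := hB j'
            simp only [Function.update_apply]
            grind)
        have hcρ : Function.update (Function.update (Function.update c f (k - i - 1)) (f + 1) i)
            dst (c dst + g i) ∘ Function.update ρ j (f + 1) = Function.update (c ∘ ρ) j i := by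
          funext j'
          have := hρ j'
          have := hne j'
          simp only [Function.update_apply, Function.comp]
          grind
        rw [hcρ] at h
        have h' := h.seq (Run.inc (f + 1) [] w _)
        refine ⟨t + 1, by omega, ?_⟩
        have hstart : Function.update (Function.update (Function.update (Function.update c f (k - i))
            (f + 1) i) dst (c dst + g i)) f (k - i - 1) =
            Function.update (Function.update (Function.update c f (k - i - 1)) (f + 1) i)
            dst (c dst + g i) := by
          funext j'
          simp only [Function.update_apply]
          grind
        simp only [hstart]
        refine h'.congr rfl rfl fun j' => ?_
        simp only [Function.update_apply, hgs]
        grind)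
    obtain ⟨t₃, ht₃, h₃⟩ := Run.loop_of_forall (r := f + 1) (a := .dec f) 1 k
      (fun i => ⟨[], w, Function.update (Function.update c (f + 1) (k - i)) dst (c dst + g k)⟩)
      (fun i hi => by simp only [Function.update_apply]; grind)
      (fun i hi => ⟨1, le_rfl, (Run.dec f [] w _).congr rfl rfl
        (fun k => by simp only [Function.update_apply]; grind)⟩)
    have hg0 : g 0 = 0 := rfl
    refine ⟨_, ?_, (h₁.congr rfl rfl ?_).seq ((h₂.congr rfl rfl ?_).seq (h₃.congr rfl rfl ?_))⟩
    · simp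
      have := Nat.mul_le_mul_right 2 hk
      have := Nat.mul_le_mul_right (q.eval (B + p'.eval B) + 2) hk
      have h3 : k * (q.eval (B + p'.eval B) + 1 + 1) = k * (q.eval (B + p'.eval B) + 2) := rfl
      omega
    all_goals
      intro k
      simp only [Function.update_apply]
      grind

/-- A problem is in P if it is decided by a counting expression. -/
theorem DecisionProblem.inP_of_expr (D : DecisionProblem) (a : Expr)
    (h : ∀ I env, 0 < a.eval (D.encode I) env ↔ D.Yes I) : D.InP := by
  -- 1 - (1 - a) turns a positive value into 1, the form that the machine expects in counter `0`.
  -- All variables can share counter `1`, with value 0, because the hypothesis holds for every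
  -- environment.
  obtain ⟨p, hp⟩ := (Expr.sub .one (.sub .one a)).exists_run
  refine D.inP_of_run ((Expr.sub .one (.sub .one a)).compile (fun _ => 1) 2 0) p
    (fun I => (Expr.sub .one (.sub .one a)).eval (D.encode I) fun _ => 0) ?_ ?_ fun I => ?_
  · intro I
    simp [Expr.eval]
  · intro I
    rw [← h I fun _ => 0]
    simp only [Expr.eval]
    omega
  · obtain ⟨t, ht, hr⟩ := hp (fun _ => 1) 2 0 (D.encode I) (fun _ => 0) (D.encode I).length
      (by simp) (by simp) (by simp) (by simp) le_rfl (by simp)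
    exact ⟨t, ht, hr.congr rfl rfl (fun i => by simp [Function.comp_def])⟩

end Manip

namespace Manip

open Turing Computability

/-! ### Polynomial-time counting functions -/

/-- A type of contexts: an input word together with `arity` natural numbers. -/
class Ctx (X : Type) where
  word : X → List Γ'
  arity : ℕ
  var : X → ℕ → ℕ

instance : Ctx (List Γ') where
  word w := w
  arity := 0
  var _ _ := 0

/-- The new variable gets the first unused index, so older variables keep theirs and `PF.lift` can
reuse the same expression. -/
instance {X : Type} [Ctx X] : Ctx (X × ℕ) where
  word x := Ctx.word x.1
  arity := Ctx.arity X + 1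
  var x j := if j = Ctx.arity X then x.2 else Ctx.var x.1 j

section Closure

variable {X : Type} [Ctx X]

/-- The function `f` is given by a counting expression. -/
def PF (f : X → ℕ) : Prop :=
  ∃ a : Expr, ∀ (x : X) (env : ℕ → ℕ), (∀ j < Ctx.arity X, env j = Ctx.var x j) →
    a.eval (Ctx.word x) env = f x

/-- The predicate `P` is given by a counting expression. -/
def PFPred (P : X → Prop) : Prop := ∃ f : X → ℕ, PF f ∧ ∀ x, 0 < f x ↔ P x

theorem DecisionProblem.inP_of_pfPred (D : DecisionProblem) {P : List Γ' → Prop} (hP : PFPred P)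
    (h : ∀ I, P (D.encode I) ↔ D.Yes I) : D.InP := by
  obtain ⟨f, ⟨a, ha⟩, hf⟩ := hP
  refine D.inP_of_expr a fun I env => ?_
  have := ha (D.encode I) env fun j hj => absurd hj (Nat.not_lt_zero j)
  rw [← h, ← hf, ← this]
  rfl

namespace PF

theorem congr {f g : X → ℕ} (hf : PF f) (h : ∀ x, f x = g x) : PF g := by
  rwa [← funext h]

theorem lift {f : X → ℕ} (hf : PF f) : PF fun x : X × ℕ => f x.1 := by
  obtain ⟨a, ha⟩ := hf
  refine ⟨a, fun x env h => ha x.1 env fun j hj => ?_⟩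
  rw [h j (Nat.lt_succ_of_lt hj)]
  exact if_neg hj.ne

theorem snd : PF fun x : X × ℕ => x.2 :=
  ⟨.var (Ctx.arity X), fun x env h => by
    rw [Expr.eval, h _ (Nat.lt_succ_self _)]
    exact if_pos rfl⟩

theorem length_word : PF fun x : X => (Ctx.word x).length := ⟨.len, fun _ _ _ => rfl⟩

theorem add {f g : X → ℕ} (hf : PF f) (hg : PF g) : PF fun x => f x + g x := by
  obtain ⟨a, ha⟩ := hf
  obtain ⟨b, hb⟩ := hg
  exact ⟨.add a b, fun x env h => by rw [Expr.eval, ha x env h, hb x env h]⟩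

theorem sub {f g : X → ℕ} (hf : PF f) (hg : PF g) : PF fun x => f x - g x := by
  obtain ⟨a, ha⟩ := hf
  obtain ⟨b, hb⟩ := hg
  exact ⟨.sub a b, fun x env h => by rw [Expr.eval, ha x env h, hb x env h]⟩

theorem const (k : ℕ) : PF fun _ : X => k := by
  have h1 : PF fun _ : X => 1 := ⟨.one, fun _ _ _ => rfl⟩
  induction k with
  | zero => exact (h1.sub h1).congr fun _ => rfl
  | succ k ih => exact ih.add h1

theorem sum {f : X → ℕ} {g : X → ℕ → ℕ} (hf : PF f) (hg : PF fun x : X × ℕ => g x.1 x.2) :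
    PF fun x => ∑ i ∈ Finset.range (f x), g x i := by
  obtain ⟨a, ha⟩ := hf
  obtain ⟨b, hb⟩ := hg
  refine ⟨.sum (Ctx.arity X) a b, fun x env h => ?_⟩
  rw [Expr.eval, ha x env h]
  refine Finset.sum_congr rfl fun i _ => hb (x, i) _ fun j hj => ?_
  change _ = if j = Ctx.arity X then i else Ctx.var x j
  have hj : j < Ctx.arity X + 1 := hj
  rw [Function.update_apply]
  split_ifs with h'
  · rfl
  · exact h j (by omega)

/-- A product is a bounded sum with constant summand. -/
theorem mul {f g : X → ℕ} (hf : PF f) (hg : PF g) : PF fun x => f x * g x :=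
  (sum (g := fun x _ => g x) hf hg.lift).congr fun x => by simp

theorem min {f g : X → ℕ} (hf : PF f) (hg : PF g) : PF fun x => min (f x) (g x) :=
  (hf.sub (hf.sub hg)).congr fun x => by omega

theorem ite {P : X → Prop} [∀ x, Decidable (P x)] {f g : X → ℕ} (hP : PFPred P) (hf : PF f)
    (hg : PF g) : PF fun x => if P x then f x else g x := by
  obtain ⟨p, hp, h⟩ := hP
  have h1 : PF fun x => 1 - p x := (const 1).sub hp
  refine ((((const 1).sub h1).mul hf).add (h1.mul hg)).congr fun x => ?_
  have := h x
  split_ifs with hx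
  · have : 1 - p x = 0 := by have := this.2 hx; omega
    simp [this]
  · have : p x = 0 := by
      by_contra h0
      exact hx (this.1 (Nat.pos_of_ne_zero h0))
    simp [this]

end PF

namespace PFPred

theorem congr {P Q : X → Prop} (hP : PFPred P) (h : ∀ x, P x ↔ Q x) : PFPred Q := by
  rwa [← funext fun x => propext (h x)]

theorem sym (s : Γ') {f : X → ℕ} (hf : PF f) : PFPred fun x => (Ctx.word x)[f x]? = some s := by
  obtain ⟨a, ha⟩ := hf
  refine ⟨fun x => if (Ctx.word x)[f x]? = some s then 1 else 0,
    ⟨.sym s a, fun x env h => by rw [Expr.eval, ha x env h]⟩, fun x => ?_⟩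
  dsimp only
  split_ifs with h <;> simp [h]

theorem and {P Q : X → Prop} (hP : PFPred P) (hQ : PFPred Q) : PFPred fun x => P x ∧ Q x := by
  obtain ⟨p, hp, h⟩ := hP
  obtain ⟨q, hq, h'⟩ := hQ
  exact ⟨_, hp.mul hq, fun x => by rw [CanonicallyOrderedAdd.mul_pos, h, h']⟩

theorem not {P : X → Prop} (hP : PFPred P) : PFPred fun x => ¬ P x := by
  obtain ⟨p, hp, h⟩ := hP
  exact ⟨_, (PF.const 1).sub hp, fun x => by have := h x; grind⟩

theorem or {P Q : X → Prop} (hP : PFPred P) (hQ : PFPred Q) : PFPred fun x => P x ∨ Q x :=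
  (hP.not.and hQ.not).not.congr fun x => by tauto

theorem imp {P Q : X → Prop} (hP : PFPred P) (hQ : PFPred Q) : PFPred fun x => P x → Q x :=
  (hP.not.or hQ).congr fun x => by tauto

theorem lt {f g : X → ℕ} (hf : PF f) (hg : PF g) : PFPred fun x => f x < g x :=
  ⟨_, hg.sub hf, fun x => by omega⟩

theorem le {f g : X → ℕ} (hf : PF f) (hg : PF g) : PFPred fun x => f x ≤ g x :=
  (lt hg hf).not.congr fun _ => not_lt

theorem eq {f g : X → ℕ} (hf : PF f) (hg : PF g) : PFPred fun x => f x = g x :=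
  ((le hf hg).and (le hg hf)).congr fun _ => le_antisymm_iff.symm

theorem exists_lt {f : X → ℕ} {P : X → ℕ → Prop} (hf : PF f)
    (hP : PFPred fun x : X × ℕ => P x.1 x.2) : PFPred fun x => ∃ i < f x, P x i := by
  obtain ⟨p, hp, h⟩ := hP
  refine ⟨_, hf.sum (g := fun x i => p (x, i)) hp, fun x => ?_⟩
  have h' : ∀ i, 0 < p (x, i) ↔ P x i := fun i => h (x, i)
  simp only [← h', pos_iff_ne_zero, ne_eq, Finset.sum_eq_zero_iff, Finset.mem_range, not_forall,
    exists_prop]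

theorem forall_lt {f : X → ℕ} {P : X → ℕ → Prop} (hf : PF f)
    (hP : PFPred fun x : X × ℕ => P x.1 x.2) : PFPred fun x => ∀ i < f x, P x i :=
  (exists_lt (P := fun x i => ¬ P x i) hf hP.not).not.congr fun x => by push Not; rfl

end PFPred

end Closure

end Manip

namespace Manip

open Turing Computability

/-! ### Truncated powers of two by counting -/

/-- Being a power of two, expressed by divisibility. -/
def IsTwoPow (a : ℕ) : Prop :=
  0 < a ∧ ∀ d < a + 1, (∃ e < a + 1, d * e = a) → d = 1 ∨ ∃ e < a + 1, d = 2 * e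

/-- A positive number that is not a power of two has an odd prime divisor, which is neither 1 nor
even. This replaces exponentiation, which is not available to counting expressions, by bounded
quantifiers and products. -/
theorem isTwoPow_iff {a : ℕ} : IsTwoPow a ↔ ∃ b, a = 2 ^ b := by
  constructor
  · rintro ⟨h0, h⟩
    rcases Nat.eq_two_pow_or_exists_odd_prime_and_dvd a with h1 | ⟨p, hp, ⟨e, rfl⟩, hodd⟩
    · exact h1
    · have he : 0 < e := Nat.pos_of_mul_pos_left h0
      have hle : p ≤ p * e := Nat.le_mul_of_pos_right p he
      have hle' : e ≤ p * e := Nat.le_mul_of_pos_left e hp.pos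
      rcases h p (by omega) ⟨e, by omega, rfl⟩ with h2 | ⟨d, _, h2⟩
      · exact absurd h2 hp.one_lt.ne'
      · exact absurd hodd (by rw [h2]; simp)
  · rintro ⟨b, rfl⟩
    refine ⟨by positivity, fun d _ ⟨e, _, he⟩ => ?_⟩
    obtain ⟨k, -, rfl⟩ := (Nat.dvd_prime_pow Nat.prime_two).1 (Dvd.intro e he)
    rcases k with _ | k
    · left
      rfl
    · right
      exact ⟨2 ^ k, by rw [pow_succ] at *; omega, by rw [pow_succ, mul_comm]⟩

open Classical in
/-- `2 ^ b` truncated at `N`. -/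
noncomputable def truncPow (N b : ℕ) : ℕ :=
  let s := ∑ a ∈ Finset.range (N + 1),
    if IsTwoPow a ∧ (∑ c ∈ Finset.range a, if IsTwoPow c then 1 else 0) = b then a else 0
  if s = 0 then N else s

/-- The powers of two below `2 ^ b` are those with exponent below `b`; thus the exponent is
recovered by counting. -/
theorem card_isTwoPow_lt (b : ℕ) [DecidablePred IsTwoPow] :
    (∑ c ∈ Finset.range (2 ^ b), if IsTwoPow c then 1 else 0) = b := by
  rw [Finset.sum_boole]
  have : (Finset.range (2 ^ b)).filter IsTwoPow = (Finset.range b).image (2 ^ ·) := by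
    ext c
    simp only [Finset.mem_filter, Finset.mem_range, isTwoPow_iff, Finset.mem_image]
    constructor
    · rintro ⟨h, k, rfl⟩
      exact ⟨k, (Nat.pow_lt_pow_iff_right (by norm_num)).1 h, rfl⟩
    · rintro ⟨k, h, rfl⟩
      exact ⟨(Nat.pow_lt_pow_iff_right (by norm_num)).2 h, k, rfl⟩
  rw [this, Finset.card_image_of_injective _ (Nat.pow_right_injective le_rfl)]
  simp

/-- The sum has at most one nonzero term, namely `2 ^ b` if it is at most `N`. As powers are
positive, the value 0 signals that `2 ^ b` exceeds `N`. -/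
theorem truncPow_eq (N b : ℕ) : truncPow N b = min (2 ^ b) N := by
  classical
  have key : (∑ a ∈ Finset.range (N + 1),
      if IsTwoPow a ∧ (∑ c ∈ Finset.range a, if IsTwoPow c then 1 else 0) = b then a else 0) =
      if 2 ^ b ≤ N then 2 ^ b else 0 := by
    have h : ∀ a, (IsTwoPow a ∧ (∑ c ∈ Finset.range a, if IsTwoPow c then 1 else 0) = b) ↔
        2 ^ b = a := by
      intro a
      constructor
      · rintro ⟨h1, h2⟩
        obtain ⟨k, rfl⟩ := isTwoPow_iff.1 h1
        rw [card_isTwoPow_lt] at h2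
        rw [h2]
      · rintro rfl
        exact ⟨isTwoPow_iff.2 ⟨b, rfl⟩, card_isTwoPow_lt b⟩
    simp only [h]
    rw [Finset.sum_ite_eq]
    simp
  simp only [truncPow]
  rw [show (∑ a ∈ Finset.range (N + 1),
      if IsTwoPow a ∧ (∑ c ∈ Finset.range a, if IsTwoPow c then 1 else 0) = b then a else 0) =
      if 2 ^ b ≤ N then 2 ^ b else 0 from key]
  have : 0 < 2 ^ b := by positivity
  split_ifs <;> omega

section

variable {X : Type} [Ctx X]

theorem PFPred.isTwoPow {f : X → ℕ} (hf : PF f) : PFPred fun x => IsTwoPow (f x) := by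
  have hf1 : PF fun x : X × ℕ => f x.1 + 1 := hf.lift.add (.const 1)
  refine (PFPred.lt (.const 0) hf).and (PFPred.forall_lt (hf.add (.const 1)) (.imp ?_ (.or ?_ ?_)))
  · exact .exists_lt hf1 (.eq (PF.snd.lift.mul .snd) hf.lift.lift)
  · exact .eq .snd (.const 1)
  · exact .exists_lt hf1 (.eq PF.snd.lift (.mul (.const 2) .snd))

theorem PF.truncPow {f g : X → ℕ} (hf : PF f) (hg : PF g) :
    PF fun x => truncPow (f x) (g x) := by
  classical
  have h : PF fun x => ∑ a ∈ Finset.range (f x + 1),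
      if IsTwoPow a ∧ (∑ c ∈ Finset.range a, if IsTwoPow c then 1 else 0) = g x then a else 0 :=
    .sum (hf.add (.const 1)) (.ite (.and (.isTwoPow .snd)
      (.eq (.sum .snd (.ite (.isTwoPow .snd) (.const 1) (.const 0))) hg.lift)) .snd (.const 0))
  refine (PF.ite (.eq h (.const 0)) hf h).congr fun x => ?_
  simp only [Manip.truncPow]

end

/-! ### Parsing encoded lists of lists by counting -/

/-- The number of complete lists before position `p`. -/
def ketsBefore (w : List Γ') (p : ℕ) : ℕ :=
  ∑ q ∈ Finset.range p, if w[q]? = some .ket then 1 else 0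

/-- The number of complete entries of the current list before position `p`. -/
def commasBefore (w : List Γ') (p : ℕ) : ℕ :=
  ∑ q ∈ Finset.range p, if w[q]? = some .comma ∧ ketsBefore w q = ketsBefore w p then 1 else 0

/-- The number of bits of the current entry before position `p`. -/
def bitsBefore (w : List Γ') (p : ℕ) : ℕ :=
  ∑ q ∈ Finset.range p, if (w[q]? = some (.bit true) ∨ w[q]? = some (.bit false)) ∧
    ketsBefore w q = ketsBefore w p ∧ commasBefore w q = commasBefore w p then 1 else 0

/-- The contribution of position `p` to the entry `j` of list `i`. -/
def entryBit (w : List Γ') (i j p : ℕ) : ℕ :=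
  if w[p]? = some (.bit true) ∧ ketsBefore w p = i ∧ commasBefore w p = j then
    2 ^ bitsBefore w p else 0

/-- The entry `j` of list `i`. -/
def entry (w : List Γ') (i j : ℕ) : ℕ := ∑ p ∈ Finset.range w.length, entryBit w i j p

/-- The length of list `i`. -/
def listLength (w : List Γ') (i : ℕ) : ℕ :=
  ∑ p ∈ Finset.range w.length, if w[p]? = some .comma ∧ ketsBefore w p = i then 1 else 0

/-- The number of lists. -/
def numLists (w : List Γ') : ℕ := ketsBefore w w.length

/-! ### How the parse changes when one symbol is appended. -/

theorem ketsBefore_append {u v : List Γ'} {p : ℕ} (hp : p ≤ u.length) :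
    ketsBefore (u ++ v) p = ketsBefore u p :=
  Finset.sum_congr rfl fun q hq => by
    rw [List.getElem?_append_left (by rw [Finset.mem_range] at hq; omega)]

theorem commasBefore_append {u v : List Γ'} {p : ℕ} (hp : p ≤ u.length) :
    commasBefore (u ++ v) p = commasBefore u p :=
  Finset.sum_congr rfl fun q hq => by
    rw [Finset.mem_range] at hq
    rw [List.getElem?_append_left (by omega), ketsBefore_append hp, ketsBefore_append (by omega)]

theorem bitsBefore_append {u v : List Γ'} {p : ℕ} (hp : p ≤ u.length) :
    bitsBefore (u ++ v) p = bitsBefore u p :=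
  Finset.sum_congr rfl fun q hq => by
    rw [Finset.mem_range] at hq
    rw [List.getElem?_append_left (by omega), ketsBefore_append hp, ketsBefore_append (by omega),
      commasBefore_append hp, commasBefore_append (by omega)]

theorem entryBit_append {u v : List Γ'} {i j p : ℕ} (hp : p < u.length) :
    entryBit (u ++ v) i j p = entryBit u i j p := by
  unfold entryBit
  rw [List.getElem?_append_left hp, ketsBefore_append hp.le, commasBefore_append hp.le,
    bitsBefore_append hp.le]

theorem ketsBefore_mono (w : List Γ') : Monotone (ketsBefore w) := fun _ _ h =>
  Finset.sum_le_sum_of_subset (Finset.range_mono h)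

theorem commasBefore_mono {w : List Γ'} {p q : ℕ} (h : p ≤ q) (hk : ketsBefore w p = ketsBefore w q) :
    commasBefore w p ≤ commasBefore w q := by
  unfold commasBefore
  rw [hk]
  exact Finset.sum_le_sum_of_subset (Finset.range_mono h)

/-- What the counts say after reading the prefix `u`. -/
structure PrefixState where
  kets : ℕ
  commas : ℕ
  bits : ℕ
  entry : ℕ → ℕ → ℕ
  len : ℕ → ℕ

/-- The counts are defined by global sums; collecting them at the right end of a prefix makes them
behave like the state of a left-to-right parser, so that encodings can be treated by induction. -/
def prefixState (u : List Γ') : PrefixState :=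
  ⟨ketsBefore u u.length, commasBefore u u.length, bitsBefore u u.length, entry u, listLength u⟩

theorem ketsBefore_snoc (u : List Γ') (s : Γ') : ketsBefore (u ++ [s]) (u.length + 1) =
    ketsBefore u u.length + if s = .ket then 1 else 0 := by
  rw [ketsBefore, Finset.sum_range_succ]
  congr 1
  · exact ketsBefore_append le_rfl
  · simp

theorem entry_snoc (u : List Γ') (s : Γ') (i j : ℕ) : entry (u ++ [s]) i j = entry u i j +
    if s = .bit true ∧ ketsBefore u u.length = i ∧ commasBefore u u.length = j then
      2 ^ bitsBefore u u.length else 0 := by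
  rw [entry, List.length_append, List.length_singleton, Finset.sum_range_succ]
  congr 1
  · exact Finset.sum_congr rfl fun p hp => entryBit_append (Finset.mem_range.1 hp)
  · unfold entryBit
    rw [ketsBefore_append le_rfl, commasBefore_append le_rfl, bitsBefore_append le_rfl]
    simp

theorem listLength_snoc (u : List Γ') (s : Γ') (i : ℕ) : listLength (u ++ [s]) i =
    listLength u i + if s = .comma ∧ ketsBefore u u.length = i then 1 else 0 := by
  rw [listLength, List.length_append, List.length_singleton, Finset.sum_range_succ]
  congr 1
  · refine Finset.sum_congr rfl fun p hp => ?_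
    rw [Finset.mem_range] at hp
    rw [List.getElem?_append_left hp, ketsBefore_append hp.le]
  · rw [ketsBefore_append le_rfl]
    simp

/-- The new terminator raises the number of kets above that of every earlier position, so no comma
belongs to the current list any more. -/
theorem commasBefore_snoc_ket (u : List Γ') :
    commasBefore (u ++ [.ket]) (u.length + 1) = 0 := by
  refine Finset.sum_eq_zero fun q hq => if_neg ?_
  rw [Finset.mem_range] at hq
  rw [ketsBefore_snoc, ketsBefore_append (by omega)]
  have := ketsBefore_mono u (show q ≤ u.length by omega)
  simp
  omega

theorem commasBefore_snoc_of_ne (u : List Γ') (s : Γ') (hs : s ≠ .ket) :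
    commasBefore (u ++ [s]) (u.length + 1) =
      commasBefore u u.length + if s = .comma then 1 else 0 := by
  rw [commasBefore, Finset.sum_range_succ]
  congr 1
  · refine Finset.sum_congr rfl fun q hq => ?_
    rw [Finset.mem_range] at hq
    rw [List.getElem?_append_left hq, ketsBefore_snoc, ketsBefore_append hq.le]
    simp [hs]
  · rw [ketsBefore_snoc, ketsBefore_append le_rfl]
    simp [hs]

theorem bitsBefore_snoc_ket (u : List Γ') : bitsBefore (u ++ [.ket]) (u.length + 1) = 0 := by
  refine Finset.sum_eq_zero fun q hq => if_neg ?_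
  rw [Finset.mem_range] at hq
  rw [ketsBefore_snoc, ketsBefore_append (by omega)]
  have := ketsBefore_mono u (show q ≤ u.length by omega)
  simp
  omega

/-- Within the current list the comma count is monotone, so after a new comma every earlier position
has a smaller one and its bit belongs to a finished entry. -/
theorem bitsBefore_snoc_comma (u : List Γ') : bitsBefore (u ++ [.comma]) (u.length + 1) = 0 := by
  refine Finset.sum_eq_zero fun q hq => if_neg ?_
  rw [Finset.mem_range] at hq
  rw [ketsBefore_snoc, ketsBefore_append (by omega), commasBefore_snoc_of_ne _ _ (by simp),
    commasBefore_append (by omega)]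
  rintro ⟨-, h1, h2⟩
  have := commasBefore_mono (show q ≤ u.length by omega) (by simpa using h1)
  simp at h2
  omega

theorem bitsBefore_snoc_bit (u : List Γ') (b : Bool) :
    bitsBefore (u ++ [.bit b]) (u.length + 1) = bitsBefore u u.length + 1 := by
  rw [bitsBefore, Finset.sum_range_succ]
  congr 1
  · refine Finset.sum_congr rfl fun q hq => ?_
    rw [Finset.mem_range] at hq
    rw [List.getElem?_append_left hq, ketsBefore_snoc, ketsBefore_append hq.le,
      commasBefore_snoc_of_ne _ _ (by simp), commasBefore_append hq.le]
    simp
  · rw [ketsBefore_snoc, ketsBefore_append le_rfl, commasBefore_snoc_of_ne _ _ (by simp),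
      commasBefore_append le_rfl]
    cases b <;> simp

theorem prefixState_nil : prefixState [] = ⟨0, 0, 0, fun _ _ => 0, fun _ => 0⟩ := rfl

theorem prefixState_snoc_bit {u : List Γ'} {k c b : ℕ} {e : ℕ → ℕ → ℕ} {l : ℕ → ℕ}
    (h : prefixState u = ⟨k, c, b, e, l⟩) (x : Bool) : prefixState (u ++ [.bit x]) =
      ⟨k, c, b + 1, fun i j => e i j + if k = i ∧ c = j then x.toNat * 2 ^ b else 0, l⟩ := by
  simp only [prefixState, PrefixState.mk.injEq] at h ⊢
  obtain ⟨rfl, rfl, rfl, rfl, rfl⟩ := h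
  simp only [List.length_append, List.length_singleton]
  refine ⟨by simp [ketsBefore_snoc], by simp [commasBefore_snoc_of_ne], bitsBefore_snoc_bit u x,
    ?_, ?_⟩
  · funext i j
    rw [entry_snoc]
    cases x <;> simp
  · funext i
    simp [listLength_snoc]

theorem prefixState_snoc_comma {u : List Γ'} {k c b : ℕ} {e : ℕ → ℕ → ℕ} {l : ℕ → ℕ}
    (h : prefixState u = ⟨k, c, b, e, l⟩) : prefixState (u ++ [.comma]) =
      ⟨k, c + 1, 0, e, fun i => l i + if k = i then 1 else 0⟩ := by
  simp only [prefixState, PrefixState.mk.injEq] at h ⊢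
  obtain ⟨rfl, rfl, rfl, rfl, rfl⟩ := h
  simp only [List.length_append, List.length_singleton]
  refine ⟨by simp [ketsBefore_snoc], by simp [commasBefore_snoc_of_ne], bitsBefore_snoc_comma u,
    ?_, ?_⟩
  · funext i j
    simp [entry_snoc]
  · funext i
    simp [listLength_snoc]

theorem prefixState_snoc_ket {u : List Γ'} {k c b : ℕ} {e : ℕ → ℕ → ℕ} {l : ℕ → ℕ}
    (h : prefixState u = ⟨k, c, b, e, l⟩) : prefixState (u ++ [.ket]) = ⟨k + 1, 0, 0, e, l⟩ := by
  simp only [prefixState, PrefixState.mk.injEq] at h ⊢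
  obtain ⟨rfl, rfl, rfl, rfl, rfl⟩ := h
  simp only [List.length_append, List.length_singleton]
  refine ⟨by simp [ketsBefore_snoc], commasBefore_snoc_ket u, bitsBefore_snoc_ket u, ?_, ?_⟩
  · funext i j
    simp [entry_snoc]
  · funext i
    simp [listLength_snoc]

/-! ### Correctness of the parse on encoded lists. -/

/-- The number with the given binary digits, least significant first. -/
def ofBits : List Bool → ℕ
  | [] => 0
  | x :: l => x.toNat + 2 * ofBits l

/-- Digits come least significant first, so the weight of a bit is two to the number of bits already
read in its entry, as `entryBit` assumes. -/
theorem ofBits_encodeNat (a : ℕ) : ofBits (encodeNat a) = a := by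
  have hpos : ∀ p : PosNum, ofBits (encodePosNum p) = (p : ℕ) := by
    intro p
    induction p with
    | one => rfl
    | bit0 p ih =>
      rw [encodePosNum, ofBits, ih, PosNum.cast_bit0]
      simp
      omega
    | bit1 p ih =>
      rw [encodePosNum, ofBits, ih, PosNum.cast_bit1]
      simp
      omega
  have hnum : ∀ q : Num, ofBits (encodeNum q) = (q : ℕ) := by
    rintro (_ | p)
    · rfl
    · exact hpos p
  rw [encodeNat, hnum]
  simp

theorem prefixState_bits (x : List Bool) : ∀ {u : List Γ'} {k c b : ℕ} {e : ℕ → ℕ → ℕ} {l : ℕ → ℕ},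
    prefixState u = ⟨k, c, b, e, l⟩ → prefixState (u ++ x.map .bit) = ⟨k, c, b + x.length,
      fun i j => e i j + if k = i ∧ c = j then ofBits x * 2 ^ b else 0, l⟩ := by
  induction x with
  | nil =>
    intro u k c b e l h
    simp [h, ofBits]
  | cons y x ih =>
    intro u k c b e l h
    have := ih (prefixState_snoc_bit h y)
    rw [List.append_assoc] at this
    rw [List.map_cons, ← List.singleton_append, this]
    simp only [PrefixState.mk.injEq, true_and, and_true]
    refine ⟨by simp; omega, ?_⟩
    funext i j
    split_ifs
    · rw [ofBits]
      ring
    · rfl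

theorem prefixState_encodeNumber (a : ℕ) {u : List Γ'} {k c : ℕ} {e : ℕ → ℕ → ℕ} {l : ℕ → ℕ}
    (h : prefixState u = ⟨k, c, 0, e, l⟩) : prefixState (u ++ encodeNumber a) = ⟨k, c + 1, 0,
      fun i j => e i j + if k = i ∧ c = j then a else 0, fun i => l i + if k = i then 1 else 0⟩ := by
  have := prefixState_snoc_comma (prefixState_bits (encodeNat a) h)
  rw [encodeNumber, ← List.append_assoc, this]
  simp [ofBits_encodeNat]

theorem prefixState_numbers (x : List ℕ) : ∀ {u : List Γ'} {k c : ℕ} {e : ℕ → ℕ → ℕ} {l : ℕ → ℕ},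
    prefixState u = ⟨k, c, 0, e, l⟩ → prefixState (u ++ x.flatMap encodeNumber) =
      ⟨k, c + x.length, 0, fun i j => e i j + if k = i ∧ c ≤ j then x.getD (j - c) 0 else 0,
        fun i => l i + if k = i then x.length else 0⟩ := by
  induction x with
  | nil =>
    intro u k c e l h
    simp [h]
  | cons a x ih =>
    intro u k c e l h
    have := ih (prefixState_encodeNumber a h)
    rw [List.append_assoc] at this
    rw [List.flatMap_cons, this]
    simp only [PrefixState.mk.injEq, true_and]
    refine ⟨by simp; omega, ?_, ?_⟩
    · funext i j
      rcases lt_trichotomy c j with hj | rfl | hj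
      · obtain ⟨d, rfl⟩ := Nat.exists_eq_add_of_lt hj
        have h1 : c + d + 1 - c = d + 1 := by omega
        have h2 : c + d + 1 - (c + 1) = d := by omega
        have h3 : c ≤ c + d + 1 := by omega
        have h4 : c + 1 ≤ c + d + 1 := by omega
        have h5 : c ≠ c + d + 1 := by omega
        simp [h1, h2, h3, h5]
      · simp
      · have h1 : ¬ c ≤ j := by omega
        have h2 : ¬ c + 1 ≤ j := by omega
        simp [h1, h2, hj.ne']
    · funext i
      split_ifs
      · simp
        omega
      · rfl

theorem prefixState_encodeList (x : List ℕ) {u : List Γ'} {k : ℕ} {e : ℕ → ℕ → ℕ} {l : ℕ → ℕ}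
    (h : prefixState u = ⟨k, 0, 0, e, l⟩) : prefixState (u ++ encodeList x) =
      ⟨k + 1, 0, 0, fun i j => e i j + if k = i then x.getD j 0 else 0,
        fun i => l i + if k = i then x.length else 0⟩ := by
  have := prefixState_snoc_ket (prefixState_numbers x h)
  rw [encodeList, ← List.append_assoc, this]
  simp

theorem prefixState_encodeLists (L : List (List ℕ)) : ∀ {u : List Γ'} {k : ℕ} {e : ℕ → ℕ → ℕ}
    {l : ℕ → ℕ}, prefixState u = ⟨k, 0, 0, e, l⟩ → prefixState (u ++ encodeLists L) =
      ⟨k + L.length, 0, 0, fun i j => e i j + if k ≤ i then (L.getD (i - k) []).getD j 0 else 0,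
        fun i => l i + if k ≤ i then (L.getD (i - k) []).length else 0⟩ := by
  induction L with
  | nil =>
    intro u k e l h
    simp [h, encodeLists]
  | cons x L ih =>
    intro u k e l h
    have := ih (prefixState_encodeList x h)
    rw [List.append_assoc] at this
    rw [encodeLists, List.flatMap_cons]
    rw [encodeLists] at this
    rw [this]
    simp only [PrefixState.mk.injEq, true_and]
    refine ⟨by simp; omega, ?_, ?_⟩
    all_goals
      funext i
      try funext j
      rcases lt_trichotomy k i with hj | rfl | hj
      · obtain ⟨d, rfl⟩ := Nat.exists_eq_add_of_lt hj
        have h1 : k + d + 1 - k = d + 1 := by omega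
        have h2 : k + d + 1 - (k + 1) = d := by omega
        have h3 : k ≤ k + d + 1 := by omega
        have h5 : k ≠ k + d + 1 := by omega
        simp [h1, h2, h3, h5]
      · simp
      · have h1 : ¬ k ≤ i := by omega
        have h2 : ¬ k + 1 ≤ i := by omega
        simp [h1, h2, hj.ne']

/-- Missing lists and missing entries give empty sums, matching the defaults of `getD`; hence no
index bounds are needed. -/
theorem prefixState_of_encodeLists (L : List (List ℕ)) : prefixState (encodeLists L) =
    ⟨L.length, 0, 0, fun i j => (L.getD i []).getD j 0, fun i => (L.getD i []).length⟩ := by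
  simpa using prefixState_encodeLists L prefixState_nil

theorem numLists_encodeLists (L : List (List ℕ)) : numLists (encodeLists L) = L.length :=
  congrArg PrefixState.kets (prefixState_of_encodeLists L)

theorem entry_encodeLists (L : List (List ℕ)) (i j : ℕ) :
    entry (encodeLists L) i j = (L.getD i []).getD j 0 :=
  congrFun (congrFun (congrArg PrefixState.entry (prefixState_of_encodeLists L)) i) j

theorem listLength_encodeLists (L : List (List ℕ)) (i : ℕ) :
    listLength (encodeLists L) i = (L.getD i []).length :=
  congrFun (congrArg PrefixState.len (prefixState_of_encodeLists L)) i

/-- The entry `j` of list `i`, truncated at the length of the word. -/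
def truncEntry (w : List Γ') (i j : ℕ) : ℕ := min (entry w i j) w.length

/-- Truncating the summands does not change the truncated sum, so a binary number can be read up to
`N` using only truncated powers. -/
theorem min_sum_min {ι : Type} (s : Finset ι) (f : ι → ℕ) (N : ℕ) :
    min (∑ i ∈ s, min (f i) N) N = min (∑ i ∈ s, f i) N := by
  classical
  induction s using Finset.induction_on with
  | empty => rfl
  | insert i s hi ih =>
    rw [Finset.sum_insert hi, Finset.sum_insert hi]
    omega

/-! ### The parse as a family of counting functions. -/

section

variable {X : Type} [Ctx X]

theorem PF.ketsBefore {f : X → ℕ} (hf : PF f) : PF fun x => ketsBefore (Ctx.word x) (f x) := by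
  unfold Manip.ketsBefore
  exact .sum hf (.ite (.sym _ .snd) (.const 1) (.const 0))

theorem PF.commasBefore {f : X → ℕ} (hf : PF f) :
    PF fun x => commasBefore (Ctx.word x) (f x) := by
  unfold Manip.commasBefore
  exact .sum hf (.ite (.and (.sym _ .snd) (.eq (.ketsBefore .snd) (.ketsBefore hf.lift)))
    (.const 1) (.const 0))

theorem PF.bitsBefore {f : X → ℕ} (hf : PF f) : PF fun x => bitsBefore (Ctx.word x) (f x) := by
  unfold Manip.bitsBefore
  exact .sum hf (.ite (.and (.or (.sym _ .snd) (.sym _ .snd))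
    (.and (.eq (.ketsBefore .snd) (.ketsBefore hf.lift))
      (.eq (.commasBefore .snd) (.commasBefore hf.lift)))) (.const 1) (.const 0))

/-- The full entry may be exponential in the word length, beyond the reach of a counting expression;
truncating each power of two and then the sum keeps everything small. -/
theorem PF.truncEntry {f g : X → ℕ} (hf : PF f) (hg : PF g) :
    PF fun x => truncEntry (Ctx.word x) (f x) (g x) := by
  have h : PF fun x : X => ∑ p ∈ Finset.range (Ctx.word x).length,
      if (Ctx.word x)[p]? = some (.bit true) ∧ Manip.ketsBefore (Ctx.word x) p = f x ∧
        Manip.commasBefore (Ctx.word x) p = g x then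
        Manip.truncPow (Ctx.word x).length (Manip.bitsBefore (Ctx.word x) p) else 0 :=
    .sum .length_word (.ite (.and (.sym _ .snd) (.and (.eq (.ketsBefore .snd) hf.lift)
      (.eq (.commasBefore .snd) hg.lift))) (.truncPow PF.length_word.lift (.bitsBefore .snd))
      (.const 0))
  refine (h.min .length_word).congr fun x => ?_
  rw [Manip.truncEntry, entry]
  refine Eq.trans ?_ (min_sum_min _ _ _)
  congr 1
  refine Finset.sum_congr rfl fun p _ => ?_
  rw [entryBit, truncPow_eq]
  split_ifs <;> simp

theorem PF.listLength {f : X → ℕ} (hf : PF f) : PF fun x => listLength (Ctx.word x) (f x) := by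
  unfold Manip.listLength
  exact .sum .length_word (.ite (.and (.sym _ .snd) (.eq (.ketsBefore .snd) hf.lift))
    (.const 1) (.const 0))

theorem PF.numLists : PF fun x : X => numLists (Ctx.word x) := .ketsBefore .length_word

end

end Manip

namespace Manip

/-! ### Winners and manipulations -/

section Winner

variable {n m : ℕ}

/-- `1` if the tie-breaking preference `t` ranks `c` before `y`, otherwise `0`. -/
def tiePenalty (t : Pref m) (c y : Fin m) : ℕ := if t.symm c < t.symm y then 1 else 0

theorem tiePenalty_add_tiePenalty (t : Pref m) {c y : Fin m} (h : c ≠ y) :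
    tiePenalty t c y + tiePenalty t y c = 1 := by
  have : t.symm c ≠ t.symm y := fun h' => h (t.symm.injective h')
  unfold tiePenalty
  grind

/-- If `c` precedes `y`, then either `c` precedes `x` or `x` precedes `y`. -/
theorem tiePenalty_le (t : Pref m) (c x y : Fin m) :
    tiePenalty t c y ≤ tiePenalty t c x + tiePenalty t x y := by
  unfold tiePenalty
  grind

theorem score_add_tiePenalty_le_of_scoringRule (hm : 0 < m) (α : Fin m → ℕ) (t : Pref m)
    (P : Profile n m) (c : Fin m) :
    score α P c + tiePenalty t c (scoringRule hm α t P) ≤ score α P (scoringRule hm α t P) := by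
  have hmin := Finset.min'_mem ((coWinners α P).map t.symm.toEmbedding)
    ((coWinners_nonempty hm α P).map)
  obtain ⟨x, hx, hxe⟩ := Finset.mem_map.1 hmin
  have hx' : scoringRule hm α t P = x := by
    rw [scoringRule, tieBreak, ← hxe]
    simp
  have hle : ∀ d ∈ coWinners α P, t.symm x ≤ t.symm d := fun d hd => by
    have := Finset.min'_le _ _ (Finset.mem_map_of_mem t.symm.toEmbedding hd)
    rwa [← hxe] at this
  rw [hx']
  have hxm : ∀ d, score α P d ≤ score α P x := by simpa [coWinners] using hx
  by_cases hcx : score α P c = score α P x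
  · have hcm : c ∈ coWinners α P := by simpa [coWinners, hcx] using hxm
    have := hle c hcm
    rw [tiePenalty, if_neg (not_lt.2 this)]
    exact hxm c
  · have := hxm c
    unfold tiePenalty
    split_ifs <;> omega

/-- The penalty encodes lexicographic tie breaking as a linear inequality. Two distinct candidates
cannot both satisfy it: adding their mutual inequalities gives 1 ≤ 0, as the two penalties sum to 1.
-/
theorem scoringRule_eq_iff (hm : 0 < m) (α : Fin m → ℕ) (t : Pref m) (P : Profile n m)
    (y : Fin m) : scoringRule hm α t P = y ↔
      ∀ c, c ≠ y → score α P c + tiePenalty t c y ≤ score α P y := by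
  constructor
  · rintro rfl c -
    exact score_add_tiePenalty_le_of_scoringRule hm α t P c
  · intro h
    by_contra hne
    have h1 := h _ hne
    have h2 := score_add_tiePenalty_le_of_scoringRule hm α t P y
    have h3 := tiePenalty_add_tiePenalty t hne
    omega

/-- The score of `c` from the votes of the voters outside `M`. -/
def outScore (α : Fin m → ℕ) (P : Profile n m) (M : Finset (Fin n)) (c : Fin m) : ℕ :=
  ∑ v, if v ∈ M then 0 else α ((P v).symm c)

theorem score_eq_outScore_add (α : Fin m → ℕ) (P : Profile n m) (M : Finset (Fin n)) (c : Fin m) :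
    score α P c = outScore α P M c + ∑ v ∈ M, α ((P v).symm c) := by
  rw [score, outScore, Finset.sum_ite, Finset.sum_const_zero, zero_add, add_comm,
    ← Finset.sum_filter_add_sum_filter_not Finset.univ (· ∈ M)]
  simp

theorem score_piecewise (α : Fin m → ℕ) (P P' : Profile n m) (M : Finset (Fin n)) (c : Fin m) :
    score α (M.piecewise P' P) c = outScore α P M c + ∑ v ∈ M, α ((P' v).symm c) := by
  rw [score_eq_outScore_add _ _ M]
  congr 1
  · refine Finset.sum_congr rfl fun v _ => ?_
    by_cases hv : v ∈ M <;> simp [hv]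
  · exact Finset.sum_congr rfl fun v hv => by simp [hv]

/-! ### Rules whose least gap is attained between the first two positions. -/

/-- Move `x` to the top and `y` to the second position, without moving other candidates up. -/
theorem exists_promote (σ : Pref m) {x y i₀ i₁ : Fin m} (hxy : x ≠ y) (h₀ : (i₀ : ℕ) = 0)
    (h₁ : (i₁ : ℕ) = 1) : ∃ σ' : Pref m, σ'.symm x = i₀ ∧ σ'.symm y = i₁ ∧
      ∀ z, z ≠ x → z ≠ y → σ.symm z ≤ σ'.symm z := by
  have h01 : i₀ ≠ i₁ := fun h => by rw [h] at h₀; omega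
  have hmin : ∀ i : Fin m, i₀ ≤ i := fun i => Fin.le_def.2 (by omega)
  have hmin' : ∀ i : Fin m, i ≠ i₀ → i₁ ≤ i := fun i hi => Fin.le_def.2 (by
    have : (i : ℕ) ≠ i₀ := fun h => hi (Fin.ext h)
    omega)
  -- Two transpositions of positions: `x` with the top, then `y` with the second place. A candidate
  -- displaced by either can only drop, since the place it takes is not above the one it leaves.
  set ρ : Fin m ≃ Fin m := σ.symm.trans (Equiv.swap i₀ (σ.symm x)) with hρ
  have hρx : ρ x = i₀ := by simp [hρ]
  have hρy : ρ y ≠ i₀ := by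
    rw [← hρx]
    exact fun h => hxy (ρ.injective h).symm
  refine ⟨(ρ.trans (Equiv.swap i₁ (ρ y))).symm, ?_, ?_, ?_⟩
  · rw [Equiv.symm_symm, Equiv.trans_apply, hρx, Equiv.swap_apply_of_ne_of_ne h01 hρy.symm]
  · simp
  · intro z hzx hzy
    rw [Equiv.symm_symm, Equiv.trans_apply]
    have h1 : σ.symm z ≤ ρ z := by
      rw [hρ, Equiv.trans_apply]
      by_cases hz : σ.symm z = i₀
      · rw [hz]
        exact hmin _
      · rw [Equiv.swap_apply_of_ne_of_ne hz (fun h => hzx (σ.symm.injective h))]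
    refine h1.trans ?_
    by_cases hz : ρ z = i₁
    · rw [hz, Equiv.swap_apply_left]
      exact hmin' _ hρy
    · rw [Equiv.swap_apply_of_ne_of_ne hz (fun h => hzy (ρ.injective h))]

/-- The score vector is antitone, the first two entries differ by `g`, and any two entries differ
by at least `g`. -/
structure HasMinGap (α : Fin m → ℕ) (g : ℕ) : Prop where
  antitone : Antitone α
  top : ∀ i₀ i₁ : Fin m, (i₀ : ℕ) = 0 → (i₁ : ℕ) = 1 → α i₀ = α i₁ + g
  le : ∀ i j, i < j → α j + g ≤ α i

theorem one_lt_of_ne {x y : Fin m} (h : x ≠ y) : 1 < m := by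
  by_contra hm
  exact h (Fin.ext (by omega))

/-- Each manipulator gives x at least `g` more points than `y`, which yields necessity. Conversely
the votes of `exists_promote` attain exactly `g`; they do not lower the score of x and do not raise
that of any third candidate c, so c remains behind x and, by transitivity, behind `y`. -/
theorem isCoalitionAgainst_iff_of_hasMinGap {α : Fin m → ℕ} {g : ℕ} (hα : HasMinGap α g)
    (hm : 0 < m) (t : Pref m) (P : Profile n m) (M : Finset (Fin n)) (y : Fin m) :
    IsCoalitionAgainst (scoringRule hm α t) P M y ↔ y ≠ scoringRule hm α t P ∧
      outScore α P M (scoringRule hm α t P) + g * M.card + tiePenalty t (scoringRule hm α t P) y ≤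
        outScore α P M y := by
  unfold IsCoalitionAgainst
  refine and_congr_right fun hy => ?_
  have hwin := score_add_tiePenalty_le_of_scoringRule hm α t P
  generalize scoringRule hm α t P = x at *
  constructor
  · rintro ⟨P', hP', h⟩
    rw [scoringRule_eq_iff] at h
    have h1 := h x hy.symm
    rw [score_piecewise, score_piecewise] at h1
    have h2 : ∑ v ∈ M, (α ((P' v).symm y) + g) ≤ ∑ v ∈ M, α ((P' v).symm x) :=
      Finset.sum_le_sum fun v hv => hα.le _ _ (hP' v hv)
    rw [Finset.sum_add_distrib, Finset.sum_const, smul_eq_mul, mul_comm] at h2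
    omega
  · intro h
    have h1m := one_lt_of_ne hy
    set i₀ : Fin m := ⟨0, hm⟩
    set i₁ : Fin m := ⟨1, h1m⟩
    choose P' hx hy' hz using fun v => exists_promote (P v) (i₀ := i₀) (i₁ := i₁) hy.symm rfl rfl
    refine ⟨P', fun v _ => ?_, (scoringRule_eq_iff _ _ _ _ _).2 fun c hc => ?_⟩
    · rw [Pref.Prefers, hx, hy']
      exact Fin.lt_def.2 Nat.zero_lt_one
    have hsx : score α (M.piecewise P' P) x = outScore α P M x + M.card * α i₀ := by
      simp [score_piecewise, hx]
    have hsy : score α (M.piecewise P' P) y = outScore α P M y + M.card * α i₁ := by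
      simp [score_piecewise, hy']
    have hxy : score α (M.piecewise P' P) x + tiePenalty t x y ≤
        score α (M.piecewise P' P) y := by
      rw [hsx, hsy, hα.top i₀ i₁ rfl rfl, mul_add, mul_comm M.card g]
      omega
    by_cases hcx : c = x
    · rwa [hcx]
    · have h1 : score α (M.piecewise P' P) c ≤ score α P c := by
        rw [score_piecewise, score_eq_outScore_add α P M]
        exact Nat.add_le_add_left
          (Finset.sum_le_sum fun v _ => hα.antitone (hz v c hcx hc)) _
      have h2 : score α P x ≤ score α (M.piecewise P' P) x := by
        rw [hsx, score_eq_outScore_add α P M, ← smul_eq_mul]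
        exact Nat.add_le_add_left (Finset.sum_le_card_nsmul _ _ _
          fun v _ => hα.antitone (Fin.le_def.2 (Nat.zero_le _))) _
      have h3 := hwin c
      have h4 := tiePenalty_le t c x y
      omega

/-! ### Small coalitions: the voters with the largest gains. -/

/-- Greedy choice: a maximiser of `d` on the complement is added repeatedly. -/
theorem exists_upper_finset {ι : Type} [Fintype ι] [DecidableEq ι] (d : ι → ℕ) (k : ℕ)
    (hk : k ≤ Fintype.card ι) :
    ∃ M : Finset ι, M.card = k ∧ ∀ u ∉ M, ∀ v ∈ M, d u ≤ d v := by
  induction k with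
  | zero => exact ⟨∅, rfl, by simp⟩
  | succ k ih =>
    obtain ⟨M, hM, h⟩ := ih (by omega)
    have hne : Mᶜ.Nonempty := by
      rw [← Finset.card_pos, Finset.card_compl]
      omega
    obtain ⟨w, hw, hmax⟩ := Finset.exists_max_image Mᶜ d hne
    rw [Finset.mem_compl] at hw
    refine ⟨insert w M, by rw [Finset.card_insert_of_notMem hw, hM], fun u hu v hv => ?_⟩
    rw [Finset.mem_insert, not_or] at hu
    rcases Finset.mem_insert.1 hv with rfl | hv
    · exact hmax u (Finset.mem_compl.2 hu.2)
    · exact h u hu.2 v hv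

/-- Layer-cake summation: `d v` is the number of levels `j` strictly below it. -/
theorem sum_eq_sum_card_filter_lt {ι : Type} (s : Finset ι) (d : ι → ℕ) (J : ℕ)
    (hJ : ∀ v, d v ≤ J) :
    ∑ v ∈ s, d v = ∑ j ∈ Finset.range J, (s.filter fun v => j < d v).card := by
  simp_rw [Finset.card_filter]
  rw [Finset.sum_comm]
  refine Finset.sum_congr rfl fun v _ => ?_
  rw [Finset.sum_boole]
  have : (Finset.range J).filter (· < d v) = Finset.range (d v) := by
    ext j
    have := hJ v
    simp only [Finset.mem_filter, Finset.mem_range]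
    omega
  simp [this]

/-- A set of top voters is optimal at all levels simultaneously: either all its members exceed level
`j`, or some member does not, and then everyone exceeding `j` already lies in it. -/
theorem exists_sum_min_card_le {ι : Type} [Fintype ι] [DecidableEq ι] (d : ι → ℕ) (k J : ℕ)
    (hJ : ∀ v, d v ≤ J) : ∃ M : Finset ι, M.card ≤ k ∧
      ∑ j ∈ Finset.range J, min k (Finset.univ.filter fun v => j < d v).card ≤ ∑ v ∈ M, d v := by
  obtain ⟨M, hM, h⟩ := exists_upper_finset d (min k (Fintype.card ι)) (min_le_right _ _)
  refine ⟨M, by omega, ?_⟩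
  rw [sum_eq_sum_card_filter_lt M d J hJ]
  refine Finset.sum_le_sum fun j _ => ?_
  by_cases hj : ∀ v ∈ M, j < d v
  · rw [Finset.filter_true_of_mem hj, hM]
    exact min_le_min_left _ (Finset.card_le_univ _)
  · push Not at hj
    obtain ⟨v, hv, hjv⟩ := hj
    refine (min_le_right _ _).trans (Finset.card_le_card fun u hu => ?_)
    simp only [Finset.mem_filter, Finset.mem_univ, true_and] at hu ⊢
    refine ⟨by_contra fun hu' => ?_, hu⟩
    have := h u hu' v hv
    omega

/-- By the criterion for a fixed coalition, a voter helps by its gain α(x) - α(y) - `g`. The level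
sum bounds the total gain of any `k` voters, and the voters of largest gain attain it. -/
theorem exists_isCoalitionAgainst_iff_of_hasMinGap {α : Fin m → ℕ} {g : ℕ} (hα : HasMinGap α g)
    (hm : 0 < m) (t : Pref m) (P : Profile n m) (k J : ℕ) (hJ : ∀ i, α i ≤ J) (y : Fin m) :
    (∃ M : Finset (Fin n), M.card ≤ k ∧ IsCoalitionAgainst (scoringRule hm α t) P M y) ↔
      y ≠ scoringRule hm α t P ∧
      score α P (scoringRule hm α t P) + tiePenalty t (scoringRule hm α t P) y ≤
        score α P y + ∑ j ∈ Finset.range J, min k (Finset.univ.filter fun v =>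
          α ((P v).symm y) + g + j < α ((P v).symm (scoringRule hm α t P))).card := by
  simp only [isCoalitionAgainst_iff_of_hasMinGap hα]
  generalize scoringRule hm α t P = x
  set d : Fin n → ℕ := fun v => α ((P v).symm x) - (α ((P v).symm y) + g) with hd
  have hdJ : ∀ v, d v ≤ J := fun v => (Nat.sub_le _ _).trans (hJ _)
  have hdj : ∀ j v, α ((P v).symm y) + g + j < α ((P v).symm x) ↔ j < d v := fun j v => by
    simp only [hd]
    omega
  simp only [hdj]
  have hcrit : ∀ M : Finset (Fin n),
      outScore α P M x + g * M.card + tiePenalty t x y ≤ outScore α P M y ↔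
      score α P x + tiePenalty t x y + ∑ v ∈ M, (α ((P v).symm y) + g) ≤
        score α P y + ∑ v ∈ M, α ((P v).symm x) := by
    intro M
    rw [score_eq_outScore_add α P M x, score_eq_outScore_add α P M y, Finset.sum_add_distrib,
      Finset.sum_const, smul_eq_mul, mul_comm]
    omega
  simp only [hcrit]
  constructor
  · rintro ⟨M, hM, hy, h⟩
    refine ⟨hy, ?_⟩
    have h1 : ∑ v ∈ M, α ((P v).symm x) ≤ ∑ v ∈ M, (α ((P v).symm y) + g) + ∑ v ∈ M, d v := by
      rw [← Finset.sum_add_distrib]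
      exact Finset.sum_le_sum fun v _ => by simp only [hd]; omega
    have h2 : ∑ v ∈ M, d v ≤
        ∑ j ∈ Finset.range J, min k (Finset.univ.filter fun v => j < d v).card := by
      rw [sum_eq_sum_card_filter_lt M d J hdJ]
      exact Finset.sum_le_sum fun j _ => le_min ((Finset.card_filter_le _ _).trans hM)
        (Finset.card_le_card (Finset.filter_subset_filter _ (Finset.subset_univ M)))
    omega
  · rintro ⟨hy, h⟩
    obtain ⟨M, hM, hsum⟩ := exists_sum_min_card_le d k J hdJ
    -- `d` is a truncated difference, so a voter with d = 0 may have negative gain. Dropping such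
    -- voters keeps the sum of `d` and makes the subtraction exact.
    refine ⟨M.filter fun v => 0 < d v, (Finset.card_filter_le _ _).trans hM, hy, ?_⟩
    have h1 : ∑ v ∈ M.filter (fun v => 0 < d v), α ((P v).symm x) =
        ∑ v ∈ M.filter (fun v => 0 < d v), (α ((P v).symm y) + g) + ∑ v ∈ M, d v := by
      have h2 : ∑ v ∈ M, d v = ∑ v ∈ M.filter (fun v => 0 < d v), d v := by
        rw [Finset.sum_filter]
        exact Finset.sum_congr rfl fun v _ => by split_ifs <;> omega
      rw [h2, ← Finset.sum_add_distrib]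
      refine Finset.sum_congr rfl fun v hv => ?_
      have := (Finset.mem_filter.1 hv).2
      simp only [hd] at this ⊢
      omega
    omega

/-! ### Plurality -/

/-- The score vector of plurality. -/
def pluralityVec (i : Fin m) : ℕ := if (i : ℕ) < 1 then 1 else 0

theorem pluralityVec_symm (σ : Pref m) (hm : 0 < m) (c : Fin m) :
    pluralityVec (σ.symm c) = if σ ⟨0, hm⟩ = c then 1 else 0 := by
  unfold pluralityVec
  congr 1
  rw [Nat.lt_one_iff, ← Equiv.eq_symm_apply, Fin.ext_iff]
  exact propext eq_comm

/-- If c = x, then `y` is put second; otherwise `x` is put second, and `y` is necessarily lower. -/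
theorem exists_pref_top {c x y : Fin m} (hm : 0 < m) (hcy : c ≠ y) (hxy : x ≠ y) :
    ∃ σ : Pref m, σ ⟨0, hm⟩ = c ∧ σ.Prefers x y := by
  have h1m := one_lt_of_ne hcy
  by_cases hcx : c = x
  · obtain ⟨σ, h0, h1, -⟩ := exists_promote (Equiv.refl (Fin m)) (i₀ := ⟨0, hm⟩) (i₁ := ⟨1, h1m⟩)
      hcy rfl rfl
    refine ⟨σ, by rw [← h0]; simp, ?_⟩
    rw [Pref.Prefers, ← hcx, h0, h1]
    exact Fin.lt_def.2 Nat.zero_lt_one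
  · obtain ⟨σ, h0, h1, -⟩ := exists_promote (Equiv.refl (Fin m)) (i₀ := ⟨0, hm⟩) (i₁ := ⟨1, h1m⟩)
      hcx rfl rfl
    refine ⟨σ, by rw [← h0]; simp, ?_⟩
    have h2 : σ.symm y ≠ σ.symm c := fun h => hcy (σ.symm.injective h).symm
    have h3 : σ.symm y ≠ σ.symm x := fun h => hxy (σ.symm.injective h).symm
    rw [h0, ne_eq, Fin.ext_iff] at h2
    rw [h1, ne_eq, Fin.ext_iff] at h3
    rw [Pref.Prefers, h1]
    refine Fin.lt_def.2 ?_
    dsimp only at *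
    omega

/-- The elements of `M` are injected into the disjoint union of `cap c` slots for each `c`; elements
outside `M` get an arbitrary value in `S`. -/
theorem exists_assignment {ι κ : Type} [DecidableEq κ] [Fintype κ] (M : Finset ι)
    (S : Finset κ) (cap : κ → ℕ) (hS : S.Nonempty) (h : M.card ≤ ∑ c ∈ S, cap c) :
    ∃ f : ι → κ, (∀ v, f v ∈ S) ∧ ∀ c ∈ S, (M.filter fun v => f v = c).card ≤ cap c := by
  classical
  have hcard : Fintype.card M ≤ Fintype.card (Σ c : S, Fin (cap c)) := by
    simpa [Finset.sum_attach S cap] using h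
  obtain ⟨e⟩ := Function.Embedding.nonempty_of_card_le hcard
  obtain ⟨c₀, hc₀⟩ := hS
  refine ⟨fun v => if hv : v ∈ M then ((e ⟨v, hv⟩).1 : κ) else c₀, fun v => ?_, fun c hc => ?_⟩
  · dsimp only
    split_ifs with hv
    · exact (e ⟨v, hv⟩).1.2
    · exact hc₀
  · rw [← Finset.card_range (cap c)]
    refine Finset.card_le_card_of_injOn
      (fun v => if hv : v ∈ M then ((e ⟨v, hv⟩).2 : ℕ) else 0) (fun v hv => ?_)
      (fun u hu v hv huv => ?_)
    · obtain ⟨hvM, hvc⟩ := Finset.mem_filter.1 hv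
      simp only [hvM, dif_pos] at hvc ⊢
      rw [Finset.coe_range, Set.mem_Iio, ← hvc]
      exact (e ⟨v, hvM⟩).2.2
    · obtain ⟨huM, huc⟩ := Finset.mem_filter.1 hu
      obtain ⟨hvM, hvc⟩ := Finset.mem_filter.1 hv
      simp only [huM, hvM, dif_pos] at huc hvc huv
      have : e ⟨u, huM⟩ = e ⟨v, hvM⟩ := by
        generalize e ⟨u, huM⟩ = a at *
        generalize e ⟨v, hvM⟩ = b at *
        obtain ⟨⟨a, ha⟩, i⟩ := a
        obtain ⟨⟨b, hb⟩, j⟩ := b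
        dsimp only at *
        subst huc hvc
        rw [Fin.ext huv]
      simpa using e.injective this

/-- The number of voters in `M` that rank `c` first. -/
theorem sum_pluralityVec (hm : 0 < m) (P : Profile n m) (M : Finset (Fin n)) (c : Fin m) :
    ∑ v ∈ M, pluralityVec ((P v).symm c) = (M.filter fun v => P v ⟨0, hm⟩ = c).card := by
  simp [pluralityVec_symm _ hm]

theorem sum_sum_pluralityVec (hm : 0 < m) (P : Profile n m) (M : Finset (Fin n)) :
    ∑ c, ∑ v ∈ M, pluralityVec ((P v).symm c) = M.card := by
  rw [Finset.sum_comm]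
  simp [pluralityVec_symm _ hm]

/-- Voters in `M` cannot put `y` first, so `y` keeps its points from outside, while the `M.card`
points are distributed freely among the other candidates. The summand for c is the number of points
that c can receive and still lose to `y`. -/
theorem isCoalitionAgainst_plurality_iff (hm : 0 < m) (t : Pref m) (P : Profile n m)
    (M : Finset (Fin n)) (y : Fin m) :
    IsCoalitionAgainst (scoringRule hm pluralityVec t) P M y ↔
      y ≠ scoringRule hm pluralityVec t P ∧
      (∀ c, c ≠ y → outScore pluralityVec P M c + tiePenalty t c y ≤
        outScore pluralityVec P M y) ∧
      M.card ≤ ∑ c ∈ Finset.univ.erase y,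
        (outScore pluralityVec P M y - outScore pluralityVec P M c - tiePenalty t c y) := by
  unfold IsCoalitionAgainst
  refine and_congr_right fun hy => ?_
  generalize scoringRule hm pluralityVec t P = x at *
  constructor
  · rintro ⟨P', hP', h⟩
    rw [scoringRule_eq_iff] at h
    have hy0 : ∑ v ∈ M, pluralityVec ((P' v).symm y) = 0 := by
      refine Finset.sum_eq_zero fun v hv => ?_
      have := Fin.lt_def.1 (hP' v hv)
      rw [pluralityVec, if_neg (by omega)]
    have hc : ∀ c, c ≠ y → outScore pluralityVec P M c + ∑ v ∈ M, pluralityVec ((P' v).symm c) +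
        tiePenalty t c y ≤ outScore pluralityVec P M y := fun c hc => by
      have := h c hc
      rwa [score_piecewise, score_piecewise, hy0, add_zero] at this
    refine ⟨fun c hcy => by have := hc c hcy; omega, ?_⟩
    rw [← sum_sum_pluralityVec hm P' M, ← Finset.add_sum_erase _ _ (Finset.mem_univ y), hy0,
      zero_add]
    exact Finset.sum_le_sum fun c hcy => by
      have := hc c (Finset.ne_of_mem_erase hcy)
      omega
  · rintro ⟨hc, hcard⟩
    obtain ⟨f, hf, hcap⟩ := exists_assignment M _ _
      ⟨x, Finset.mem_erase.2 ⟨hy.symm, Finset.mem_univ x⟩⟩ hcard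
    choose P' htop hpref using fun v => exists_pref_top hm (Finset.ne_of_mem_erase (hf v)) hy.symm
    refine ⟨P', fun v _ => hpref v, (scoringRule_eq_iff _ _ _ _ _).2 fun c hcy => ?_⟩
    have h1 := hcap c (Finset.mem_erase.2 ⟨hcy, Finset.mem_univ c⟩)
    have h2 := hc c hcy
    rw [score_piecewise, score_piecewise, sum_pluralityVec hm, sum_pluralityVec hm]
    simp only [htop]
    omega

/-- The first inequality counts the supporters that must be removed from candidates too strong for
`y`; the second says that all `n` points fit when `y` keeps its score and each rival stays behind
it. Including supporters of `y` in the coalition never helps, as it only lowers the threshold. -/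
theorem exists_isCoalitionAgainst_plurality_iff (hm : 0 < m) (hn : 0 < n) (t : Pref m)
    (P : Profile n m) (k : ℕ) (y : Fin m) :
    (∃ M : Finset (Fin n), M.card ≤ k ∧
      IsCoalitionAgainst (scoringRule hm pluralityVec t) P M y) ↔
      y ≠ scoringRule hm pluralityVec t P ∧
      ∑ c ∈ Finset.univ.erase y,
        (score pluralityVec P c - (score pluralityVec P y - tiePenalty t c y)) ≤ k ∧
      n ≤ score pluralityVec P y +
        ∑ c ∈ Finset.univ.erase y, (score pluralityVec P y - tiePenalty t c y) := by
  simp only [isCoalitionAgainst_plurality_iff]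
  generalize scoringRule hm pluralityVec t P = x at *
  have hn' : score pluralityVec P y + ∑ c ∈ Finset.univ.erase y, score pluralityVec P c = n := by
    rw [Finset.add_sum_erase _ _ (Finset.mem_univ y)]
    simpa [score] using sum_sum_pluralityVec hm P Finset.univ
  constructor
  · rintro ⟨M, hM, hy, hc, hcard⟩
    have hs := score_eq_outScore_add pluralityVec P M
    have hin := sum_sum_pluralityVec hm P M
    rw [← Finset.add_sum_erase _ _ (Finset.mem_univ y)] at hin
    have hsy := hs y
    refine ⟨hy, ?_, ?_⟩
    · refine le_trans (Finset.sum_le_sum fun c hcy => ?_) (le_trans (b := ∑ c ∈ Finset.univ.erase y,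
        ∑ v ∈ M, pluralityVec ((P v).symm c)) le_rfl (by omega))
      have := hc c (Finset.ne_of_mem_erase hcy)
      have := hs c
      omega
    · have h1 : ∑ c ∈ Finset.univ.erase y, score pluralityVec P c =
          ∑ c ∈ Finset.univ.erase y, outScore pluralityVec P M c +
          ∑ c ∈ Finset.univ.erase y, ∑ v ∈ M, pluralityVec ((P v).symm c) := by
        rw [← Finset.sum_add_distrib]
        exact Finset.sum_congr rfl fun c _ => hs c
      have h2 : ∑ c ∈ Finset.univ.erase y, outScore pluralityVec P M c +
          ∑ c ∈ Finset.univ.erase y,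
            (outScore pluralityVec P M y - outScore pluralityVec P M c - tiePenalty t c y) ≤
          ∑ c ∈ Finset.univ.erase y, (score pluralityVec P y - tiePenalty t c y) := by
        rw [← Finset.sum_add_distrib]
        exact Finset.sum_le_sum fun c hcy => by
          have := hc c (Finset.ne_of_mem_erase hcy)
          omega
      omega
  · rintro ⟨hy, hk, hcap⟩
    -- With score zero the capacity would be zero, contradicting `0 < n`. Positivity makes the
    -- subtraction of the penalty exact.
    have hpos : 0 < score pluralityVec P y := by
      by_contra h0
      have h0 : score pluralityVec P y = 0 := by omega
      rw [h0] at hcap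
      simp at hcap
      omega
    have hτ : ∀ c, tiePenalty t c y ≤ score pluralityVec P y := fun c => by
      unfold tiePenalty
      split_ifs <;> omega
    set ex : Fin m → ℕ := fun c => if c = y then 0 else
      score pluralityVec P c - (score pluralityVec P y - tiePenalty t c y) with hex
    have hsc : ∀ c, score pluralityVec P c =
        (Finset.univ.filter fun v => P v ⟨0, hm⟩ = c).card :=
      fun c => sum_pluralityVec hm P Finset.univ c
    have hT : ∀ c, ∃ T ⊆ (Finset.univ.filter fun v => P v ⟨0, hm⟩ = c), T.card = ex c := fun c =>
      Finset.exists_subset_card_eq (by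
        rw [← hsc]
        simp only [hex]
        split_ifs <;> omega)
    choose T hTs hTc using hT
    -- `T c` holds exactly the excess supporters of `c`, so outside `M` every rival has the smaller
    -- of its score and its allowed maximum, and `y` loses nobody.
    set M : Finset (Fin n) := Finset.univ.filter fun v => v ∈ T (P v ⟨0, hm⟩) with hMdef
    have hMT : ∀ c, (M.filter fun v => P v ⟨0, hm⟩ = c) = T c := by
      intro c
      ext v
      simp only [hMdef, Finset.mem_filter, Finset.mem_univ, true_and]
      constructor
      · rintro ⟨h1, rfl⟩
        exact h1
      · intro h
        obtain rfl := (Finset.mem_filter.1 (hTs c h)).2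
        exact ⟨h, rfl⟩
    have hs : ∀ c, score pluralityVec P c = outScore pluralityVec P M c + ex c := fun c => by
      rw [score_eq_outScore_add pluralityVec P M c, sum_pluralityVec hm, hMT, hTc]
    have hMcard : M.card = ∑ c ∈ Finset.univ.erase y, ex c := by
      rw [← sum_sum_pluralityVec hm P M, ← Finset.add_sum_erase _ _ (Finset.mem_univ y)]
      simp only [sum_pluralityVec hm, hMT, hTc]
      simp [hex]
    have hexy : ex y = 0 := by simp [hex]
    have hexc : ∀ c, c ≠ y →
        ex c = score pluralityVec P c - (score pluralityVec P y - tiePenalty t c y) :=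
      fun c hc => by simp [hex, hc]
    have hsy := hs y
    refine ⟨M, ?_, hy, fun c hc => ?_, ?_⟩
    · rw [hMcard]
      refine le_trans (Finset.sum_le_sum fun c hc => ?_) hk
      exact (hexc c (Finset.ne_of_mem_erase hc)).le
    · have := hs c
      have := hexc c hc
      have := hτ c
      omega
    · rw [hMcard]
      have h1 : ∑ c ∈ Finset.univ.erase y, (score pluralityVec P y - tiePenalty t c y) =
          ∑ c ∈ Finset.univ.erase y, (outScore pluralityVec P M y - outScore pluralityVec P M c -
            tiePenalty t c y) + ∑ c ∈ Finset.univ.erase y, outScore pluralityVec P M c := by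
        rw [← Finset.sum_add_distrib]
        refine Finset.sum_congr rfl fun c hc => ?_
        have := hs c
        have := hexc c (Finset.ne_of_mem_erase hc)
        have := hτ c
        omega
      have h2 : ∑ c ∈ Finset.univ.erase y, score pluralityVec P c =
          ∑ c ∈ Finset.univ.erase y, outScore pluralityVec P M c +
          ∑ c ∈ Finset.univ.erase y, ex c := by
        rw [← Finset.sum_add_distrib]
        exact Finset.sum_congr rfl fun c _ => hs c
      omega

end Winner

end Manip

namespace Manip

open Turing Computability

/-! ### Elections as numerical data -/

/-- An election seen through numbers: the numbers of candidates and voters, the points that a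
candidate gets from a voter, and the tie penalty. -/
structure Tally where
  m : ℕ
  n : ℕ
  pts : ℕ → ℕ → ℕ
  tie : ℕ → ℕ → ℕ

namespace Tally

open Classical in
/-- The score of `c` from the voters outside `S`. -/
noncomputable def out (D : Tally) (S : ℕ → Prop) (c : ℕ) : ℕ :=
  ∑ v ∈ Finset.range D.n, if S v then 0 else D.pts v c

open Classical in
/-- The number of voters in `S`. -/
noncomputable def card (D : Tally) (S : ℕ → Prop) : ℕ :=
  ∑ v ∈ Finset.range D.n, if S v then 1 else 0

/-- The score of `c`. -/
def total (D : Tally) (c : ℕ) : ℕ := ∑ v ∈ Finset.range D.n, D.pts v c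

/-- `x` is the winner. -/
def Wins (D : Tally) (x : ℕ) : Prop :=
  ∀ c < D.m, ¬ c = x → D.total c + D.tie c x ≤ D.total x

/-- The criterion for `S` to be a coalition against `y` if the winner is `x` and the least gap of
the score vector is `g`. -/
def GapAgainst (D : Tally) (g : ℕ) (S : ℕ → Prop) (x y : ℕ) : Prop :=
  D.out S x + g * D.card S + D.tie x y ≤ D.out S y

/-- The criterion for the existence of a coalition of size at most `k` against `y` if the winner
is `x` and the least gap of the score vector is `g`. -/
def GapSearch (D : Tally) (g k x y : ℕ) : Prop :=
  D.total x + D.tie x y ≤ D.total y + ∑ j ∈ Finset.range D.m,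
    min k (∑ v ∈ Finset.range D.n, if D.pts v y + g + j < D.pts v x then 1 else 0)

/-- The criterion for `S` to be a coalition against the loser `y` under plurality. -/
def PluralityAgainst (D : Tally) (S : ℕ → Prop) (y : ℕ) : Prop :=
  (∀ c < D.m, ¬ c = y → D.out S c + D.tie c y ≤ D.out S y) ∧
    D.card S ≤ ∑ c ∈ Finset.range D.m, if c = y then 0 else D.out S y - D.out S c - D.tie c y

/-- The criterion for the existence of a coalition of size at most `k` against the loser `y` under
plurality. -/
def PluralitySearch (D : Tally) (k y : ℕ) : Prop :=
  (∑ c ∈ Finset.range D.m,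
    if c = y then 0 else D.total c - (D.total y - D.tie c y)) ≤ k ∧
  D.n ≤ D.total y + ∑ c ∈ Finset.range D.m, if c = y then 0 else D.total y - D.tie c y

/-- The numerical data are those of an election. -/
structure Represents {n m : ℕ} (D : Tally) (α : Fin m → ℕ) (t : Pref m) (P : Profile n m) :
    Prop where
  m_eq : D.m = m
  n_eq : D.n = n
  pts_eq : ∀ (v : Fin n) (c : Fin m), D.pts v c = α ((P v).symm c)
  tie_eq : ∀ c y : Fin m, D.tie c y = tiePenalty t c y

namespace Represents

variable {n m : ℕ} {D : Tally} {α : Fin m → ℕ} {t : Pref m} {P : Profile n m}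

theorem total_eq (h : D.Represents α t P) (c : Fin m) : D.total c = score α P c := by
  rw [Tally.total, h.n_eq, Finset.sum_range]
  exact Finset.sum_congr rfl fun v _ => h.pts_eq v c

theorem out_eq (h : D.Represents α t P) {S : ℕ → Prop} {M : Finset (Fin n)}
    (hS : ∀ v : Fin n, S v ↔ v ∈ M) (c : Fin m) : D.out S c = outScore α P M c := by
  rw [Tally.out, h.n_eq, Finset.sum_range]
  refine Finset.sum_congr rfl fun v _ => ?_
  rw [h.pts_eq]
  by_cases hv : v ∈ M <;> simp [hS, hv]

theorem card_eq (h : D.Represents α t P) {S : ℕ → Prop} {M : Finset (Fin n)}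
    (hS : ∀ v : Fin n, S v ↔ v ∈ M) : D.card S = M.card := by
  rw [Tally.card, h.n_eq, Finset.sum_range]
  simp [hS]

theorem wins_iff (h : D.Represents α t P) (hm : 0 < m) (x : Fin m) :
    D.Wins x ↔ x = scoringRule hm α t P := by
  rw [eq_comm, scoringRule_eq_iff, Tally.Wins, h.m_eq]
  refine ⟨fun hw c hc => ?_, fun hw c hcm hc => ?_⟩
  · rw [← h.total_eq, ← h.total_eq, ← h.tie_eq]
    exact hw c c.2 fun h' => hc (Fin.ext h')
  · have := hw ⟨c, hcm⟩ fun h' => hc (Fin.ext_iff.1 h')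
    rwa [← h.total_eq, ← h.total_eq, ← h.tie_eq] at this

theorem sum_erase_eq (h : D.Represents α t P) (y : Fin m) (f : ℕ → ℕ) (f' : Fin m → ℕ)
    (hf : ∀ c : Fin m, f c = f' c) :
    (∑ c ∈ Finset.range D.m, if c = (y : ℕ) then 0 else f c) = ∑ c ∈ Finset.univ.erase y, f' c := by
  rw [h.m_eq, Finset.sum_range, ← Finset.add_sum_erase _ _ (Finset.mem_univ y), if_pos rfl,
    zero_add]
  refine Finset.sum_congr rfl fun c hc => ?_
  rw [if_neg fun h' => Finset.ne_of_mem_erase hc (Fin.ext h'), hf]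

/-- The winner is located by bounded search: `Wins` determines the bound variable x uniquely. -/
theorem gapAgainst_iff (h : D.Represents α t P) {S : ℕ → Prop} {M : Finset (Fin n)}
    (hS : ∀ v : Fin n, S v ↔ v ∈ M) {g : ℕ} (hα : HasMinGap α g) (hm : 0 < m) (y : Fin m) :
    (∃ x < D.m, D.Wins x ∧ ¬ (y : ℕ) = x ∧ D.GapAgainst g S x y) ↔
      IsCoalitionAgainst (scoringRule hm α t) P M y := by
  rw [isCoalitionAgainst_iff_of_hasMinGap hα, h.m_eq]
  have key : ∀ x : Fin m, D.GapAgainst g S x y ↔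
      outScore α P M x + g * M.card + tiePenalty t x y ≤ outScore α P M y := fun x => by
    rw [Tally.GapAgainst, h.out_eq hS, h.out_eq hS, h.card_eq hS, h.tie_eq]
  constructor
  · rintro ⟨x, hx, hw, hne, hg⟩
    have hw' := (h.wins_iff hm ⟨x, hx⟩).1 hw
    rw [← hw']
    exact ⟨fun h' => hne (Fin.ext_iff.1 h'), (key ⟨x, hx⟩).1 hg⟩
  · rintro ⟨hne, hg⟩
    exact ⟨_, (scoringRule hm α t P).2, (h.wins_iff hm _).2 rfl, fun h' => hne (Fin.ext h'),
      (key _).2 hg⟩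

theorem gapSearch_iff (h : D.Represents α t P) {g : ℕ} (hα : HasMinGap α g) (hm : 0 < m)
    (hle : ∀ i, α i ≤ m) (k : ℕ) (y : Fin m) :
    (∃ x < D.m, D.Wins x ∧ ¬ (y : ℕ) = x ∧ D.GapSearch g k x y) ↔
      ∃ M : Finset (Fin n), M.card ≤ k ∧
        IsCoalitionAgainst (scoringRule hm α t) P M y := by
  rw [exists_isCoalitionAgainst_iff_of_hasMinGap hα hm t P k m hle]
  have key : ∀ x : Fin m, D.GapSearch g k x y ↔ score α P x + tiePenalty t x y ≤
        score α P y + ∑ j ∈ Finset.range m, min k (Finset.univ.filter fun v =>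
          α ((P v).symm y) + g + j < α ((P v).symm x)).card := fun x => by
    rw [Tally.GapSearch, h.total_eq, h.total_eq, h.tie_eq, h.m_eq]
    simp only [h.n_eq, Finset.sum_range, h.pts_eq, Finset.card_filter]
  rw [h.m_eq]
  constructor
  · rintro ⟨x, hx, hw, hne, hg⟩
    have hw' := (h.wins_iff hm ⟨x, hx⟩).1 hw
    rw [← hw']
    exact ⟨fun h' => hne (Fin.ext_iff.1 h'), (key ⟨x, hx⟩).1 hg⟩
  · rintro ⟨hne, hg⟩
    exact ⟨_, (scoringRule hm α t P).2, (h.wins_iff hm _).2 rfl, fun h' => hne (Fin.ext h'),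
      (key _).2 hg⟩

theorem not_wins_iff (h : D.Represents α t P) (hm : 0 < m) (y : Fin m) :
    ¬ D.Wins y ↔ y ≠ scoringRule hm α t P :=
  (h.wins_iff hm y).not

theorem pluralityAgainst_iff (h : D.Represents pluralityVec t P) {S : ℕ → Prop}
    {M : Finset (Fin n)} (hS : ∀ v : Fin n, S v ↔ v ∈ M) (hm : 0 < m) (y : Fin m) :
    ¬ D.Wins y ∧ D.PluralityAgainst S y ↔
      IsCoalitionAgainst (scoringRule hm pluralityVec t) P M y := by
  rw [isCoalitionAgainst_plurality_iff, h.not_wins_iff hm]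
  refine and_congr_right fun _ => and_congr ?_ ?_
  · rw [h.m_eq]
    refine ⟨fun hw c hc => ?_, fun hw c hcm hc => ?_⟩
    · rw [← h.out_eq hS, ← h.out_eq hS, ← h.tie_eq]
      exact hw c c.2 fun h' => hc (Fin.ext h')
    · have := hw ⟨c, hcm⟩ fun h' => hc (Fin.ext_iff.1 h')
      rwa [← h.out_eq hS, ← h.out_eq hS, ← h.tie_eq] at this
  · rw [h.card_eq hS, h.sum_erase_eq y _ _ fun c => by
      rw [h.out_eq hS, h.out_eq hS, h.tie_eq]]

theorem pluralitySearch_iff (h : D.Represents pluralityVec t P) (hm : 0 < m) (hn : 0 < n)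
    (k : ℕ) (y : Fin m) :
    ¬ D.Wins y ∧ D.PluralitySearch k y ↔ ∃ M : Finset (Fin n), M.card ≤ k ∧
      IsCoalitionAgainst (scoringRule hm pluralityVec t) P M y := by
  rw [exists_isCoalitionAgainst_plurality_iff hm hn, h.not_wins_iff hm]
  refine and_congr_right fun _ => and_congr ?_ ?_
  · rw [h.sum_erase_eq y _ _ fun c => by rw [h.total_eq, h.total_eq, h.tie_eq]]
  · rw [h.sum_erase_eq y _ _ fun c => by rw [h.total_eq, h.tie_eq], h.n_eq, h.total_eq]

end Represents

/-- The numerical data are computed from the word by counting expressions. -/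
structure IsPF (D : List Γ' → Tally) : Prop where
  m : ∀ {X : Type} [Ctx X], PF fun x : X => (D (Ctx.word x)).m
  n : ∀ {X : Type} [Ctx X], PF fun x : X => (D (Ctx.word x)).n
  pts : ∀ {X : Type} [Ctx X] {f g : X → ℕ}, PF f → PF g →
    PF fun x => (D (Ctx.word x)).pts (f x) (g x)
  tie : ∀ {X : Type} [Ctx X] {f g : X → ℕ}, PF f → PF g →
    PF fun x => (D (Ctx.word x)).tie (f x) (g x)

/-- The set of numbers is computed from the word by counting expressions. -/
def IsPFSet (S : List Γ' → ℕ → Prop) : Prop :=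
  ∀ {X : Type} [Ctx X] {f : X → ℕ}, PF f → PFPred fun x => S (Ctx.word x) (f x)

/-! ### The criteria as counting predicates. -/

namespace IsPF

variable {D : List Γ' → Tally} {S : List Γ' → ℕ → Prop} {X : Type} [Ctx X] {f g k : X → ℕ}

theorem out (hD : IsPF D) (hS : IsPFSet S) (hf : PF f) :
    PF fun x => (D (Ctx.word x)).out (S (Ctx.word x)) (f x) := by
  classical
  unfold Tally.out
  exact .sum hD.n (.ite (hS .snd) (.const 0) (hD.pts .snd hf.lift))

theorem card (hD : IsPF D) (hS : IsPFSet S) :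
    PF fun x : X => (D (Ctx.word x)).card (S (Ctx.word x)) := by
  classical
  unfold Tally.card
  exact .sum hD.n (.ite (hS .snd) (.const 1) (.const 0))

theorem total (hD : IsPF D) (hf : PF f) : PF fun x => (D (Ctx.word x)).total (f x) :=
  .sum hD.n (hD.pts .snd hf.lift)

theorem wins (hD : IsPF D) (hf : PF f) : PFPred fun x => (D (Ctx.word x)).Wins (f x) :=
  .forall_lt hD.m (.imp (.not (.eq .snd hf.lift))
    (.le (.add (hD.total .snd) (hD.tie .snd hf.lift)) (hD.total hf.lift)))

theorem gapAgainst (hD : IsPF D) (hS : IsPFSet S) (c : ℕ) (hf : PF f) (hg : PF g) :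
    PFPred fun x => (D (Ctx.word x)).GapAgainst c (S (Ctx.word x)) (f x) (g x) :=
  .le (.add (.add (hD.out hS hf) (.mul (.const c) (hD.card hS))) (hD.tie hf hg)) (hD.out hS hg)

theorem gapSearch (hD : IsPF D) (c : ℕ) (hk : PF k) (hf : PF f) (hg : PF g) :
    PFPred fun x => (D (Ctx.word x)).GapSearch c (k x) (f x) (g x) :=
  .le (.add (hD.total hf) (hD.tie hf hg)) (.add (hD.total hg) (.sum hD.m (.min hk.lift
    (.sum hD.n (.ite (.lt (.add (.add (hD.pts .snd hg.lift.lift) (.const c)) PF.snd.lift)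
      (hD.pts .snd hf.lift.lift)) (.const 1) (.const 0))))))

theorem pluralityAgainst (hD : IsPF D) (hS : IsPFSet S) (hg : PF g) :
    PFPred fun x => (D (Ctx.word x)).PluralityAgainst (S (Ctx.word x)) (g x) :=
  .and (.forall_lt hD.m (.imp (.not (.eq .snd hg.lift))
      (.le (.add (hD.out hS .snd) (hD.tie .snd hg.lift)) (hD.out hS hg.lift))))
    (.le (hD.card hS) (.sum hD.m (.ite (.eq .snd hg.lift) (.const 0)
      (.sub (.sub (hD.out hS hg.lift) (hD.out hS .snd)) (hD.tie .snd hg.lift)))))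

theorem pluralitySearch (hD : IsPF D) (hk : PF k) (hg : PF g) :
    PFPred fun x => (D (Ctx.word x)).PluralitySearch (k x) (g x) :=
  .and (.le (.sum hD.m (.ite (.eq .snd hg.lift) (.const 0)
      (.sub (hD.total .snd) (.sub (hD.total hg.lift) (hD.tie .snd hg.lift))))) hk)
    (.le hD.n (.add (hD.total hg) (.sum hD.m (.ite (.eq .snd hg.lift) (.const 0)
      (.sub (hD.total hg.lift) (hD.tie .snd hg.lift))))))

end IsPF

end Tally

end Manip

namespace Manip

open Turing Computability

/-! ### Reading an election off its encoding -/

theorem length_le_length_encodeLists (L : List (List ℕ)) : L.length ≤ (encodeLists L).length := by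
  induction L with
  | nil => rfl
  | cons l L ih =>
    rw [encodeLists, List.flatMap_cons, List.length_append, List.length_cons]
    rw [encodeLists] at ih
    have : 1 ≤ (encodeList l).length := by simp [encodeList]
    omega

/-- Every entry contributes a comma and the list a ket. Applied to a ranking, this puts all
candidates below the word length, where truncation has no effect. -/
theorem length_lt_length_encodeLists {L : List (List ℕ)} {l : List ℕ} (hl : l ∈ L) :
    l.length < (encodeLists L).length := by
  have h1 : l.length ≤ (l.flatMap encodeNumber).length := by
    clear hl
    induction l with
    | nil => rfl
    | cons a l ih =>
      rw [List.flatMap_cons, List.length_append, List.length_cons]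
      have : 1 ≤ (encodeNumber a).length := by simp [encodeNumber]
      omega
  have h2 : (encodeList l).length ≤ (encodeLists L).length := by
    obtain ⟨s, t, rfl⟩ := List.append_of_mem hl
    simp only [encodeLists, List.flatMap_append, List.flatMap_cons, List.length_append]
    omega
  have h3 : (encodeList l).length = (l.flatMap encodeNumber).length + 1 := by simp [encodeList]
  omega

theorem truncEntry_encodeLists (L : List (List ℕ)) (i j : ℕ) :
    truncEntry (encodeLists L) i j = min ((L.getD i []).getD j 0) (encodeLists L).length := by
  rw [truncEntry, entry_encodeLists]

/-- The position of the number `c` in list `i`. -/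
def candPos (w : List Γ') (i c : ℕ) : ℕ :=
  ∑ q ∈ Finset.range (listLength w i), if truncEntry w i q = c then q else 0

/-- A ranking contains each candidate once, so the sum has a single relevant term, whose value is
the position sought. -/
theorem candPos_encodeLists {L : List (List ℕ)} {i m : ℕ} {σ : Pref m}
    (h : L[i]? = some σ.toList) (c : Fin m) : candPos (encodeLists L) i c = σ.symm c := by
  have hd : L.getD i [] = σ.toList := by simp [h]
  have hlen : m < (encodeLists L).length := by
    simpa [Pref.toList] using length_lt_length_encodeLists (List.mem_of_getElem? h)
  have hl : listLength (encodeLists L) i = m := by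
    rw [listLength_encodeLists, hd]
    simp [Pref.toList]
  rw [candPos, hl, Finset.sum_range]
  have he : ∀ q : Fin m, truncEntry (encodeLists L) i q = c ↔ q = σ.symm c := by
    intro q
    have := (σ q).2
    rw [truncEntry_encodeLists, hd, Equiv.eq_symm_apply, Fin.ext_iff]
    simp only [Pref.toList, List.getD_eq_getElem?_getD, List.getElem?_ofFn, q.2, dif_pos,
      Option.getD_some, Fin.eta]
    omega
  simp [he]

theorem PF.candPos {X : Type} [Ctx X] {f g : X → ℕ} (hf : PF f) (hg : PF g) :
    PF fun x => candPos (Ctx.word x) (f x) (g x) :=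
  .sum (.listLength hf) (.ite (.eq (.truncEntry hf.lift .snd) hg.lift) .snd (.const 0))

/-- The numerical data of an election whose encoding is preceded by `o` lists, where `A` is the
score vector. -/
def tallyOf (o : ℕ) (A : List Γ' → ℕ → ℕ) (w : List Γ') : Tally where
  m := listLength w (o + 1)
  n := numLists w - (o + 2)
  pts v c := A w (candPos w (o + 2 + v) c)
  tie c y := if candPos w (o + 1) c < candPos w (o + 1) y then 1 else 0

theorem isPF_tallyOf (o : ℕ) {A : List Γ' → ℕ → ℕ}
    (hA : ∀ {X : Type} [Ctx X] {f : X → ℕ}, PF f → PF fun x => A (Ctx.word x) (f x)) :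
    Tally.IsPF (tallyOf o A) where
  m := .listLength (.const _)
  n := .sub .numLists (.const _)
  pts hf hg := hA (.candPos (.add (.const _) hf) hg)
  tie hf hg := .ite (.lt (.candPos (.const _) hf) (.candPos (.const _) hg)) (.const 1) (.const 0)

section Election

variable {F : ScoringFamily} (E : Election F) (pre : List (List ℕ))

theorem getElem?_param : (pre ++ E.toLists)[pre.length]? = some (F.enc E.m E.param) := by
  simp [Election.toLists]

theorem getElem?_tie : (pre ++ E.toLists)[pre.length + 1]? = some E.tie.toList := by
  rw [List.getElem?_append_right (by omega)]
  simp [Election.toLists]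

theorem getElem?_votes (v : Fin E.n) :
    (pre ++ E.toLists)[pre.length + 2 + v]? = some (E.votes v).toList := by
  rw [List.getElem?_append_right (by omega),
    show pre.length + 2 + (v : ℕ) - pre.length = v + 1 + 1 by omega]
  simp [Election.toLists]

theorem length_election : (pre ++ E.toLists).length = pre.length + 2 + E.n := by
  simp [Election.toLists]
  omega

theorem listLength_election :
    listLength (encodeLists (pre ++ E.toLists)) (pre.length + 1) = E.m := by
  rw [listLength_encodeLists, List.getD_eq_getElem?_getD, getElem?_tie]
  simp [Pref.toList]

theorem m_lt_length_election : E.m < (encodeLists (pre ++ E.toLists)).length := by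
  simpa [Pref.toList] using
    length_lt_length_encodeLists (List.mem_of_getElem? (getElem?_tie E pre))

theorem n_le_length_election : E.n ≤ (encodeLists (pre ++ E.toLists)).length := by
  have h1 := length_le_length_encodeLists (pre ++ E.toLists)
  rw [length_election] at h1
  omega

theorem represents_tallyOf {A : List Γ' → ℕ → ℕ}
    (hA : ∀ p : Fin E.m, A (encodeLists (pre ++ E.toLists)) p = F.vec E.m E.param p) :
    (tallyOf pre.length A (encodeLists (pre ++ E.toLists))).Represents (F.vec E.m E.param) E.tie
      E.votes where
  m_eq := listLength_election E pre
  n_eq := by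
    simp only [tallyOf, numLists_encodeLists, length_election]
    omega
  pts_eq v c := by
    simp only [tallyOf]
    rw [candPos_encodeLists (getElem?_votes E pre v), hA]
  tie_eq c y := by
    simp only [tallyOf, tiePenalty]
    rw [candPos_encodeLists (getElem?_tie E pre), candPos_encodeLists (getElem?_tie E pre)]
    simp only [Fin.lt_def]

theorem mem_voterSet_iff (M : Finset (Fin E.n)) (v : Fin E.n) :
    truncEntry (encodeLists (voterSetToList M :: (pre ++ E.toLists))) 0 v = 1 ↔ v ∈ M := by
  have h := length_le_length_encodeLists (voterSetToList M :: (pre ++ E.toLists))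
  rw [List.length_cons] at h
  have hv : (voterSetToList M).getD v 0 = if v ∈ M then 1 else 0 := by simp [voterSetToList]
  rw [truncEntry_encodeLists, List.getD_cons_zero, hv]
  split_ifs with hv
  · simp only [hv, iff_true]
    omega
  · simp [hv]

end Election

/-! ### From criteria to problems in P -/

/-- Being a coalition against a candidate is expressible by counting, for sets of voters that
are. -/
def AgainstPF (F : ScoringFamily) : Prop :=
  ∀ (o : ℕ) (S : List Γ' → ℕ → Prop), Tally.IsPFSet S → ∃ C : List Γ' → ℕ → Prop,
    Tally.IsPFSet C ∧ ∀ (E : Election F) (pre : List (List ℕ)), pre.length = o →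
      ∀ M : Finset (Fin E.n), (∀ v : Fin E.n, S (encodeLists (pre ++ E.toLists)) v ↔ v ∈ M) →
      ∀ y : Fin E.m, C (encodeLists (pre ++ E.toLists)) y ↔
        IsCoalitionAgainst E.rule E.votes M y

/-- The existence of a coalition of bounded size against a candidate is expressible by counting. -/
def SearchPF (F : ScoringFamily) : Prop :=
  ∀ o : ℕ, ∃ C : List Γ' → ℕ → ℕ → Prop,
    (∀ {X : Type} [Ctx X] {f g : X → ℕ}, PF f → PF g →
      PFPred fun x => C (Ctx.word x) (f x) (g x)) ∧
    ∀ (E : Election F) (pre : List (List ℕ)), pre.length = o → ∀ (k : ℕ) (y : Fin E.m),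
      C (encodeLists (pre ++ E.toLists)) k y ↔
        ∃ M : Finset (Fin E.n), M.card ≤ k ∧ IsCoalitionAgainst E.rule E.votes M y

section

variable {F : ScoringFamily}

theorem isPFSet_voterSet : Tally.IsPFSet fun w v => truncEntry w 0 v = 1 :=
  fun hf => .eq (.truncEntry (.const 0) hf) (.const 1)

theorem AgainstPF.inP_CPMW (h : AgainstPF F) : (CPMW F).InP := by
  obtain ⟨C, hC, hiff⟩ := h 2 (fun w v => truncEntry w 0 v = 1) isPFSet_voterSet
  refine DecisionProblem.inP_of_pfPred (P := fun w => C w (truncEntry w 1 0)) _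
    (hC (.truncEntry (.const 1) (.const 0))) ?_
  rintro ⟨E, M, y⟩
  have hy : truncEntry (encodeLists ([voterSetToList M, [(y : ℕ)]] ++ E.toLists)) 1 0 = y := by
    have := y.2
    rw [truncEntry_encodeLists]
    exact min_eq_left (this.trans (m_lt_length_election E _)).le
  change C (encodeLists ([voterSetToList M, [(y : ℕ)]] ++ E.toLists)) (truncEntry (encodeLists
    ([voterSetToList M, [(y : ℕ)]] ++ E.toLists)) 1 0) ↔ IsCoalitionAgainst E.rule E.votes M y
  rw [hy]
  exact hiff E [voterSetToList M, [(y : ℕ)]] rfl M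
    (fun v => mem_voterSet_iff E [[(y : ℕ)]] M v) y

theorem AgainstPF.inP_CPM (h : AgainstPF F) : (CPM F).InP := by
  obtain ⟨C, hC, hiff⟩ := h 1 (fun w v => truncEntry w 0 v = 1) isPFSet_voterSet
  refine DecisionProblem.inP_of_pfPred (P := fun w => ∃ y < listLength w 2, C w y) _
    (.exists_lt (.listLength (.const 2)) (hC .snd)) ?_
  rintro ⟨E, M⟩
  have hm := listLength_election E [voterSetToList M]
  have := hiff E [voterSetToList M] rfl M (fun v => mem_voterSet_iff E [] M v)
  change (∃ y < listLength (encodeLists ([voterSetToList M] ++ E.toLists)) 2, _) ↔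
    IsCoalition _ _ _
  rw [show (2 : ℕ) = [voterSetToList M].length + 1 from rfl, hm]
  constructor
  · rintro ⟨y, hy, hc⟩
    exact ⟨⟨y, hy⟩, (this ⟨y, hy⟩).1 hc⟩
  · rintro ⟨y, hc⟩
    exact ⟨y, y.2, (this y).2 hc⟩

/-- The size bound is written in binary and can be huge, but there are no more voters than input
symbols. -/
theorem card_le_min_length_iff (E : Election F) (pre : List (List ℕ)) (M : Finset (Fin E.n))
    (k : ℕ) : M.card ≤ min k (encodeLists (pre ++ E.toLists)).length ↔ M.card ≤ k := by
  have h1 := n_le_length_election E pre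
  have h2 : M.card ≤ E.n := by simpa using M.card_le_univ
  omega

theorem SearchPF.inP_CPMSW (h : SearchPF F) : (CPMSW F).InP := by
  obtain ⟨C, hC, hiff⟩ := h 2
  refine DecisionProblem.inP_of_pfPred (P := fun w => C w (truncEntry w 1 0) (truncEntry w 0 0)) _
    (hC (.truncEntry (.const 1) (.const 0)) (.truncEntry (.const 0) (.const 0))) ?_
  rintro ⟨E, y, k⟩
  have hy : truncEntry (encodeLists ([[(y : ℕ)], [k]] ++ E.toLists)) 0 0 = y := by
    have := y.2
    rw [truncEntry_encodeLists]
    exact min_eq_left (this.trans (m_lt_length_election E _)).le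
  have hk : truncEntry (encodeLists ([[(y : ℕ)], [k]] ++ E.toLists)) 1 0 =
      min k (encodeLists ([[(y : ℕ)], [k]] ++ E.toLists)).length := by
    rw [truncEntry_encodeLists]
    rfl
  change C (encodeLists ([[(y : ℕ)], [k]] ++ E.toLists)) (truncEntry (encodeLists
    ([[(y : ℕ)], [k]] ++ E.toLists)) 1 0) (truncEntry (encodeLists
    ([[(y : ℕ)], [k]] ++ E.toLists)) 0 0) ↔ ∃ M : Finset (Fin E.n), M.card ≤ k ∧
    IsCoalitionAgainst E.rule E.votes M y
  rw [hy, hk, hiff E _ rfl]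
  simp only [card_le_min_length_iff]

/-- The existential quantifiers over coalitions and over candidates commute, so it suffices to try
every candidate. -/
theorem SearchPF.inP_CPMS (h : SearchPF F) : (CPMS F).InP := by
  obtain ⟨C, hC, hiff⟩ := h 1
  refine DecisionProblem.inP_of_pfPred
    (P := fun w => ∃ y < listLength w 2, C w (truncEntry w 0 0) y) _
    (.exists_lt (.listLength (.const 2)) (hC (.truncEntry (.const 0) (.const 0)) .snd)) ?_
  rintro ⟨E, k⟩
  have hm := listLength_election E [[k]]
  have hk : truncEntry (encodeLists ([[k]] ++ E.toLists)) 0 0 =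
      min k (encodeLists ([[k]] ++ E.toLists)).length := by
    rw [truncEntry_encodeLists]
    rfl
  have := hiff E [[k]] rfl (min k (encodeLists ([[k]] ++ E.toLists)).length)
  simp only [card_le_min_length_iff] at this
  change (∃ y < listLength (encodeLists ([[k]] ++ E.toLists)) 2,
    C (encodeLists ([[k]] ++ E.toLists)) (truncEntry (encodeLists ([[k]] ++ E.toLists)) 0 0) y) ↔
    ∃ M : Finset (Fin E.n), M.card ≤ k ∧ ∃ y, IsCoalitionAgainst E.rule E.votes M y
  rw [show (2 : ℕ) = [[k]].length + 1 from rfl, hm, hk]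
  constructor
  · rintro ⟨y, hy, hc⟩
    obtain ⟨M, hM, hMy⟩ := (this ⟨y, hy⟩).1 hc
    exact ⟨M, hM, _, hMy⟩
  · rintro ⟨M, hM, y, hMy⟩
    exact ⟨y, y.2, (this y).2 ⟨M, hM, hMy⟩⟩

end

/-! ### Borda and approval -/

theorem hasMinGap_borda (m : ℕ) (a : borda.Param m) : HasMinGap (borda.vec m a) 1 where
  antitone i j h := Nat.sub_le_sub_left h _
  top i₀ i₁ h₀ h₁ := by
    simp only [borda, h₀, h₁]
    omega
  le i j h := by
    have := Fin.lt_def.1 h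
    simp only [borda]
    omega

/-- With k ≥ 2 the first two positions both score 1, and gap 0 is automatic for an antitone vector.
For plurality the top gap is 1 while lower positions tie, so no `g` works for three or more
candidates. -/
theorem hasMinGap_approval (m : ℕ) (a : approval.Param m) (h : a.1 ≠ 1) :
    HasMinGap (approval.vec m a) 0 where
  antitone i j h := by
    have := Fin.le_def.1 h
    simp only [approval]
    split_ifs <;> omega
  top i₀ i₁ h₀ h₁ := by
    have := a.2.1
    simp only [approval, h₀, h₁]
    split_ifs <;> omega
  le i j h := by
    have := Fin.lt_def.1 h
    simp only [approval]
    split_ifs <;> omega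

/-- The Borda score vector, read off the input word. -/
def bordaVec (o : ℕ) (w : List Γ') (p : ℕ) : ℕ := listLength w (o + 1) - 1 - p

/-- The approval score vector, read off the input word. -/
def approvalVec (o : ℕ) (w : List Γ') (p : ℕ) : ℕ := if p < truncEntry w o 0 then 1 else 0

theorem isPF_borda (o : ℕ) : Tally.IsPF (tallyOf o (bordaVec o)) :=
  isPF_tallyOf o fun hf => .sub (.sub (.listLength (.const _)) (.const 1)) hf

theorem isPF_approval (o : ℕ) : Tally.IsPF (tallyOf o (approvalVec o)) :=
  isPF_tallyOf o fun hf =>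
    .ite (.lt hf (.truncEntry (.const _) (.const 0))) (.const 1) (.const 0)

theorem represents_borda (E : Election borda) (pre : List (List ℕ)) :
    (tallyOf pre.length (bordaVec pre.length) (encodeLists (pre ++ E.toLists))).Represents
      (borda.vec E.m E.param) E.tie E.votes :=
  represents_tallyOf E pre fun p => by rw [bordaVec, listLength_election]; rfl

theorem truncEntry_param (E : Election approval) (pre : List (List ℕ)) :
    truncEntry (encodeLists (pre ++ E.toLists)) pre.length 0 = E.param.1 := by
  have h1 := m_lt_length_election E pre
  have h2 := E.param.2.2
  have h3 : (pre ++ E.toLists).getD pre.length [] = [E.param.1] := by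
    rw [List.getD_eq_getElem?_getD, getElem?_param]
    rfl
  rw [truncEntry_encodeLists, h3]
  exact min_eq_left (h2.trans h1).le

theorem represents_approval (E : Election approval) (pre : List (List ℕ)) :
    (tallyOf pre.length (approvalVec pre.length) (encodeLists (pre ++ E.toLists))).Represents
      (approval.vec E.m E.param) E.tie E.votes :=
  represents_tallyOf E pre fun p => by rw [approvalVec, truncEntry_param]; rfl

theorem approval_vec_eq_pluralityVec {m : ℕ} {a : approval.Param m} (h : a.1 = 1) :
    approval.vec m a = pluralityVec := by
  funext p
  simp only [approval, pluralityVec, h]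

theorem againstPF_borda : AgainstPF borda := by
  intro o S hS
  refine ⟨fun w y => ∃ x < (tallyOf o (bordaVec o) w).m, (tallyOf o (bordaVec o) w).Wins x ∧
    ¬ y = x ∧ (tallyOf o (bordaVec o) w).GapAgainst 1 (S w) x y, fun hf => ?_, ?_⟩
  · have hD := isPF_borda o
    exact .exists_lt hD.m (.and (hD.wins .snd)
      (.and (.not (.eq hf.lift .snd)) (hD.gapAgainst hS 1 .snd hf.lift)))
  · rintro E pre rfl M hM y
    exact (represents_borda E pre).gapAgainst_iff hM (hasMinGap_borda _ _) E.m_pos y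

theorem searchPF_borda : SearchPF borda := by
  intro o
  refine ⟨fun w k y => ∃ x < (tallyOf o (bordaVec o) w).m, (tallyOf o (bordaVec o) w).Wins x ∧
    ¬ y = x ∧ (tallyOf o (bordaVec o) w).GapSearch 1 k x y, fun hk hf => ?_, ?_⟩
  · have hD := isPF_borda o
    exact .exists_lt hD.m (.and (hD.wins .snd)
      (.and (.not (.eq hf.lift .snd)) (hD.gapSearch 1 hk.lift .snd hf.lift)))
  · rintro E pre rfl k y
    exact (represents_borda E pre).gapSearch_iff (hasMinGap_borda _ _) E.m_pos
      (fun i => (Nat.sub_le _ _).trans (Nat.sub_le _ _)) k y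

/-- As k is part of the input, the expression itself branches on k = 1 between the capacity
criterion and the gap criterion. -/
theorem againstPF_approval : AgainstPF approval := by
  intro o S hS
  refine ⟨fun w y =>
    (truncEntry w o 0 = 1 ∧ ¬ (tallyOf o (approvalVec o) w).Wins y ∧
      (tallyOf o (approvalVec o) w).PluralityAgainst (S w) y) ∨
    (¬ truncEntry w o 0 = 1 ∧ ∃ x < (tallyOf o (approvalVec o) w).m,
      (tallyOf o (approvalVec o) w).Wins x ∧ ¬ y = x ∧
      (tallyOf o (approvalVec o) w).GapAgainst 0 (S w) x y), fun hf => ?_, ?_⟩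
  · have hD := isPF_approval o
    have h1 : ∀ {X : Type} [Ctx X], PFPred fun x : X => truncEntry (Ctx.word x) o 0 = 1 :=
      .eq (.truncEntry (.const o) (.const 0)) (.const 1)
    exact .or (.and h1 (.and (.not (hD.wins hf)) (hD.pluralityAgainst hS hf)))
      (.and h1.not (.exists_lt hD.m (.and (hD.wins .snd)
        (.and (.not (.eq hf.lift .snd)) (hD.gapAgainst hS 0 .snd hf.lift)))))
  · rintro E pre rfl M hM y
    have hrep := represents_approval E pre
    beta_reduce
    rw [truncEntry_param]
    by_cases h : E.param.1 = 1
    · simp only [h, true_and, not_true_eq_false, false_and, or_false]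
      rw [Election.rule]
      rw [approval_vec_eq_pluralityVec h] at hrep ⊢
      exact hrep.pluralityAgainst_iff hM E.m_pos y
    · simp only [h, false_and, not_false_eq_true, true_and, false_or]
      exact hrep.gapAgainst_iff hM (hasMinGap_approval _ _ h) E.m_pos y

theorem searchPF_approval : SearchPF approval := by
  intro o
  refine ⟨fun w k y =>
    (truncEntry w o 0 = 1 ∧ ¬ (tallyOf o (approvalVec o) w).Wins y ∧
      (tallyOf o (approvalVec o) w).PluralitySearch k y) ∨
    (¬ truncEntry w o 0 = 1 ∧ ∃ x < (tallyOf o (approvalVec o) w).m,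
      (tallyOf o (approvalVec o) w).Wins x ∧ ¬ y = x ∧
      (tallyOf o (approvalVec o) w).GapSearch 0 k x y), fun hk hf => ?_, ?_⟩
  · have hD := isPF_approval o
    have h1 : ∀ {X : Type} [Ctx X], PFPred fun x : X => truncEntry (Ctx.word x) o 0 = 1 :=
      .eq (.truncEntry (.const o) (.const 0)) (.const 1)
    exact .or (.and h1 (.and (.not (hD.wins hf)) (hD.pluralitySearch hk hf)))
      (.and h1.not (.exists_lt hD.m (.and (hD.wins .snd)
        (.and (.not (.eq hf.lift .snd)) (hD.gapSearch 0 hk.lift .snd hf.lift)))))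
  · rintro E pre rfl k y
    have hrep := represents_approval E pre
    beta_reduce
    rw [truncEntry_param]
    by_cases h : E.param.1 = 1
    · simp only [h, true_and, not_true_eq_false, false_and, or_false]
      rw [Election.rule]
      rw [approval_vec_eq_pluralityVec h] at hrep ⊢
      exact hrep.pluralitySearch_iff E.m_pos E.n_pos k y
    · simp only [h, false_and, not_false_eq_true, true_and, false_or]
      refine hrep.gapSearch_iff (hasMinGap_approval _ _ h) E.m_pos (fun i => ?_) k y
      have := E.m_pos
      simp only [approval]
      split_ifs <;> omega

end Manip

theorem mainTheorem4 :
    ((Manip.CPMW Manip.borda).InP ∧ (Manip.CPM Manip.borda).InP ∧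
      (Manip.CPMSW Manip.borda).InP ∧ (Manip.CPMS Manip.borda).InP) ∧
    ((Manip.CPMW Manip.approval).InP ∧ (Manip.CPM Manip.approval).InP ∧
      (Manip.CPMSW Manip.approval).InP ∧ (Manip.CPMS Manip.approval).InP) :=
  ⟨⟨Manip.againstPF_borda.inP_CPMW, Manip.againstPF_borda.inP_CPM,
    Manip.searchPF_borda.inP_CPMSW, Manip.searchPF_borda.inP_CPMS⟩,
   Manip.againstPF_approval.inP_CPMW, Manip.againstPF_approval.inP_CPM,
    Manip.searchPF_approval.inP_CPMSW, Manip.searchPF_approval.inP_CPMS⟩
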